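/- Let $\Omega\subset\mathbb R^2$ be a bounded domain (open and connected) with smooth boundary $\Gamma=\partial\Omega$, and let $\Gamma$ be partitioned into three pairwise disjoint measurable parts $\Gamma_1,\Gamma_2,\Gamma_3$ of positive arc length. Let $\xi>0$ and $g>0$ be constants, $f_0\in L^2(\Omega)$ and $f_2\in L^2(\Gamma_2)$. Let $\gamma:H^1(\Omega)\to L^2(\Gamma)$ be the trace operator and put $$X=\{v\in H^1(\Omega)\ :\ \gamma v=0\ \text{a.e. on }\Gamma_1\},\qquad (u,v)_X=(\nabla u,\nabla v)_{L^2(\Omega)^2},\qquad \|v\|_X=(v,v)_X^{1/2}.$$ Let $X'$ be the dual of $X$ (the linear functionals on $X$ that are continuous with respect to $\|\cdot\|_X$), with duality pairing $\langle\cdot,\cdot\rangle_{X',X}$. Set $$a(u,v)=\xi\,(u,v)_X,\qquad j(v)=\int_{\Gamma_3}g\,|\gamma v|\,d\Gamma,\qquad \bar\Lambda=\{\bar\mu\in X'\ :\ \langle\bar\mu,v\rangle_{X',X}\le j(v)\ \text{for all }v\in X\}.$$ Then there is exactly one pair $(\bar u,\bar\lambda)\in X\times\bar\Lambda$ such that $$a(\bar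 u,v)+\langle\bar\lambda,v\rangle_{X',X}=\int_\Omega f_0\,v\,dx+\int_{\Gamma_2}f_2\,\gamma v\,d\Gamma\quad\text{for all }v\in X,$$ $$\langle\bar\mu-\bar\lambda,\bar u\rangle_{X',X}\le 0\quad\text{for all }\bar\mu\in\bar\Lambda.$$ -/

import Mathlib

open MeasureTheory Measure Set
open scoped ContDiff RealInnerProductSpace

noncomputable section

namespace AntiplaneFriction

/-- The Euclidean plane. -/
abbrev Plane : Type := EuclideanSpace ℝ (Fin 2)

/-- The partial derivative of `φ` in the `i`-th coordinate direction at `x`. -/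
def partialDeriv (i : Fin 2) (φ : Plane → ℝ) (x : Plane) : ℝ :=
  fderiv ℝ φ x (EuclideanSpace.single i 1)

/-- Smooth boundary: near each boundary point, after a rigid motion of the coordinate axes, `Ω` is
the part of a small disc that lies strictly above the graph of a `C^∞` function. -/
def HasSmoothBoundary (Ω : Set Plane) : Prop :=
  ∀ p ∈ frontier Ω, ∃ (e : Plane ≃ₗᵢ[ℝ] Plane) (h : ℝ → ℝ) (r : ℝ),
    0 < r ∧ ContDiff ℝ ∞ h ∧ ∀ x ∈ Metric.ball p r, (x ∈ Ω ↔ h (e x 0) < e x 1)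

/-- A bounded domain (open connected set) of the plane with smooth boundary. -/
structure IsSmoothBoundedDomain (Ω : Set Plane) : Prop where
  isOpen : IsOpen Ω
  isConnected : IsConnected Ω
  isBounded : Bornology.IsBounded Ω
  smoothBoundary : HasSmoothBoundary Ω

/-- `Γ₁, Γ₂, Γ₃` partition the boundary of `Ω` into measurable parts of positive arc length
(the one-dimensional Hausdorff measure `μH[1]`). -/
structure IsBoundaryPartition (Ω Γ₁ Γ₂ Γ₃ : Set Plane) : Prop where
  union_eq : Γ₁ ∪ Γ₂ ∪ Γ₃ = frontier Ω
  disjoint₁₂ : Disjoint Γ₁ Γ₂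
  disjoint₁₃ : Disjoint Γ₁ Γ₃
  disjoint₂₃ : Disjoint Γ₂ Γ₃
  measurable₁ : MeasurableSet Γ₁
  measurable₂ : MeasurableSet Γ₂
  measurable₃ : MeasurableSet Γ₃
  pos₁ : 0 < μH[1] Γ₁
  pos₂ : 0 < μH[1] Γ₂
  pos₃ : 0 < μH[1] Γ₃

/-- `L²(Ω)`. -/
abbrev L2 (Ω : Set Plane) : Type := Lp ℝ 2 (volume.restrict Ω)

/-- `L²(Ω)²`, with its usual Hilbert space structure. -/
abbrev L2Vec (Ω : Set Plane) : Type := Lp Plane 2 (volume.restrict Ω)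

/-- `L²(S)` with respect to arc length, for a piece `S` of a curve. -/
abbrev L2Arc (S : Set Plane) : Type := Lp ℝ 2 ((μH[1] : Measure Plane).restrict S)

/-- `p` is the weak gradient of `u` in `Ω`, tested against `C_c^∞(Ω)`. -/
def IsWeakGradient (Ω : Set Plane) (u : L2 Ω) (p : L2Vec Ω) : Prop :=
  ∀ φ : Plane → ℝ, ContDiff ℝ ∞ φ → HasCompactSupport φ → tsupport φ ⊆ Ω →
    ∀ i : Fin 2, ∫ x in Ω, u x * partialDeriv i φ x = -∫ x in Ω, p x i * φ x

theorem memLp_of_test {Ω : Set Plane} {φ : Plane → ℝ} (hφ : ContDiff ℝ ∞ φ)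
    (hc : HasCompactSupport φ) : MemLp φ 2 (volume.restrict Ω) :=
  (hφ.continuous.memLp_of_hasCompactSupport hc).restrict Ω

theorem memLp_partialDeriv {Ω : Set Plane} {φ : Plane → ℝ} (hφ : ContDiff ℝ ∞ φ)
    (hc : HasCompactSupport φ) (i : Fin 2) :
    MemLp (partialDeriv i φ) 2 (volume.restrict Ω) := by
  have h1 : Continuous (partialDeriv i φ) :=
    (hφ.continuous_fderiv (by simp)).clm_apply continuous_const
  have h2 : HasCompactSupport (partialDeriv i φ) := hc.fderiv_apply ℝ _
  exact (h1.memLp_of_hasCompactSupport h2).restrict Ω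

theorem memLp_coord {Ω : Set Plane} (p : L2Vec Ω) (i : Fin 2) :
    MemLp (fun x => p x i) 2 (volume.restrict Ω) :=
  (EuclideanSpace.proj (𝕜 := ℝ) i : Plane →L[ℝ] ℝ).comp_memLp' (Lp.memLp p)

/-- `H¹(Ω)`, realised as the space of pairs `(u, ∇u)` of an `L²` function and its weak gradient in
`L²`, with `‖u‖² = ‖u‖²_{L²} + ‖∇u‖²_{L²}`. The second component is determined by the first. -/
def H1 (Ω : Set Plane) : Submodule ℝ (WithLp 2 (L2 Ω × L2Vec Ω)) where
  carrier := {w | IsWeakGradient Ω w.fst w.snd}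
  zero_mem' := by
    intro φ _ _ _ i
    have h1 : ∫ x in Ω, ((0 : L2 Ω) : Plane → ℝ) x * partialDeriv i φ x = 0 := by
      rw [integral_eq_zero_of_ae]
      filter_upwards [Lp.coeFn_zero ℝ 2 (volume.restrict Ω)] with x hx
      rw [hx]; simp
    have h2 : ∫ x in Ω, ((0 : L2Vec Ω) : Plane → Plane) x i * φ x = 0 := by
      rw [integral_eq_zero_of_ae]
      filter_upwards [Lp.coeFn_zero Plane 2 (volume.restrict Ω)] with x hx
      rw [hx]; simp
    exact h1.trans (by rw [← neg_eq_zero] at h2; exact h2.symm)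
  add_mem' := by
    intro v w hv hw φ hφ hc hs i
    have e1 : ∫ x in Ω, (v.fst + w.fst : L2 Ω) x * partialDeriv i φ x
        = (∫ x in Ω, v.fst x * partialDeriv i φ x)
          + ∫ x in Ω, w.fst x * partialDeriv i φ x := by
      refine Eq.trans ?_ (integral_add ((Lp.memLp v.fst).integrable_mul (memLp_partialDeriv hφ hc i))
        ((Lp.memLp w.fst).integrable_mul (memLp_partialDeriv hφ hc i)))
      apply integral_congr_ae
      filter_upwards [Lp.coeFn_add v.fst w.fst] with x hx
      rw [hx]; simp [add_mul]
    have e2 : ∫ x in Ω, (v.snd + w.snd : L2Vec Ω) x i * φ x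
        = (∫ x in Ω, v.snd x i * φ x) + ∫ x in Ω, w.snd x i * φ x := by
      refine Eq.trans ?_ (integral_add ((memLp_coord v.snd i).integrable_mul (memLp_of_test hφ hc))
        ((memLp_coord w.snd i).integrable_mul (memLp_of_test hφ hc)))
      apply integral_congr_ae
      filter_upwards [Lp.coeFn_add v.snd w.snd] with x hx
      rw [hx]; simp [add_mul]
    change ∫ x in Ω, (v.fst + w.fst : L2 Ω) x * partialDeriv i φ x
      = -∫ x in Ω, (v.snd + w.snd : L2Vec Ω) x i * φ x
    rw [e1, e2, hv φ hφ hc hs i, hw φ hφ hc hs i]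
    ring
  smul_mem' := by
    intro c v hv φ hφ hc hs i
    have e1 : ∫ x in Ω, (c • v.fst : L2 Ω) x * partialDeriv i φ x
        = c * ∫ x in Ω, v.fst x * partialDeriv i φ x := by
      rw [← integral_const_mul]
      apply integral_congr_ae
      filter_upwards [Lp.coeFn_smul c v.fst] with x hx
      rw [hx]; simp [mul_assoc]
    have e2 : ∫ x in Ω, (c • v.snd : L2Vec Ω) x i * φ x
        = c * ∫ x in Ω, v.snd x i * φ x := by
      rw [← integral_const_mul]
      apply integral_congr_ae
      filter_upwards [Lp.coeFn_smul c v.snd] with x hx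
      rw [hx]; simp [mul_assoc]
    change ∫ x in Ω, (c • v.fst : L2 Ω) x * partialDeriv i φ x
      = -∫ x in Ω, (c • v.snd : L2Vec Ω) x i * φ x
    rw [e1, e2, hv φ hφ hc hs i]
    ring

/-- The underlying `L²` function of an element of `H¹(Ω)`. -/
def H1.toL2 {Ω : Set Plane} (v : H1 Ω) : L2 Ω := v.1.fst

/-- The weak gradient of an element of `H¹(Ω)`. -/
def H1.grad {Ω : Set Plane} (v : H1 Ω) : L2Vec Ω := v.1.snd

/-- The defining property of the trace operator: a continuous linear map `H¹(Ω) → L²(∂Ω)` that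
restricts to the boundary every function which is smooth up to the boundary. -/
def IsTraceOperator (Ω : Set Plane) (T : H1 Ω →L[ℝ] L2Arc (frontier Ω)) : Prop :=
  ∀ (v : H1 Ω) (φ : Plane → ℝ), ContDiff ℝ ∞ φ → H1.toL2 v =ᵐ[volume.restrict Ω] φ →
    T v =ᵐ[(μH[1] : Measure Plane).restrict (frontier Ω)] φ

open Classical in
/-- The trace operator `γ : H¹(Ω) → L²(∂Ω)`. On a bounded domain with smooth boundary exactly one
operator has the defining property, and this is it; elsewhere the value may be a default. -/
def trace (Ω : Set Plane) : H1 Ω →L[ℝ] L2Arc (frontier Ω) :=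
  if h : ∃ T, IsTraceOperator Ω T then h.choose else 0

/-- The functions in `H¹(Ω)` whose trace vanishes almost everywhere on `Γ₁`. -/
def vanishingOn (Ω Γ₁ : Set Plane) : Submodule ℝ (H1 Ω) where
  carrier := {v | ∀ᵐ x ∂((μH[1] : Measure Plane).restrict (frontier Ω)),
    x ∈ Γ₁ → trace Ω v x = 0}
  zero_mem' := by
    simp only [mem_ofPred_eq, map_zero]
    filter_upwards [Lp.coeFn_zero ℝ 2 ((μH[1] : Measure Plane).restrict (frontier Ω))]
      with x hx _
    rw [hx]; simp
  add_mem' := by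
    intro v w hv hw
    simp only [mem_ofPred_eq, map_add] at *
    filter_upwards [Lp.coeFn_add (trace Ω v) (trace Ω w), hv, hw] with x hx h1 h2 h
    rw [hx, Pi.add_apply, h1 h, h2 h, add_zero]
  smul_mem' := by
    intro c v hv
    simp only [mem_ofPred_eq, map_smul] at *
    filter_upwards [Lp.coeFn_smul c (trace Ω v), hv] with x hx h1 h
    rw [hx, Pi.smul_apply, h1 h, smul_zero]

/-- The space `X = {v ∈ H¹(Ω) | γ v = 0 a.e. on Γ₁}`, as a type of its own: it carries the inner
product `(u, v)_X = (∇u, ∇v)_{L²(Ω)²}` (see the instances below), not the one of `H¹(Ω)`. -/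
def X (Ω Γ₁ : Set Plane) : Type := vanishingOn Ω Γ₁

namespace X

variable {Ω Γ₁ : Set Plane}

instance : AddCommGroup (X Ω Γ₁) := inferInstanceAs (AddCommGroup (vanishingOn Ω Γ₁))

instance : Module ℝ (X Ω Γ₁) := inferInstanceAs (Module ℝ (vanishingOn Ω Γ₁))

/-- The inclusion of `X` in `H¹(Ω)`. -/
def toH1 : X Ω Γ₁ →ₗ[ℝ] H1 Ω := (vanishingOn Ω Γ₁).subtype

/-- The weak gradient of an element of `X`, as a linear map. -/
def grad : X Ω Γ₁ →ₗ[ℝ] L2Vec Ω where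
  toFun v := H1.grad (toH1 v)
  map_add' _ _ := rfl
  map_smul' _ _ := rfl

/-- The norm `‖v‖_X = ‖∇v‖_{L²(Ω)²}`. (As usual in Mathlib, an inner product structure may be put
over a seminorm; nothing about definiteness is presupposed.) -/
instance : SeminormedAddCommGroup (X Ω Γ₁) := SeminormedAddCommGroup.induced _ _ grad

/-- The inner product `(u, v)_X = (∇u, ∇v)_{L²(Ω)²}`. -/
instance : InnerProductSpace ℝ (X Ω Γ₁) where
  norm_smul_le c v := by
    change ‖grad (c • v)‖ ≤ ‖c‖ * ‖grad v‖
    rw [map_smul, norm_smul]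
  inner u v := ⟪grad u, grad v⟫
  norm_sq_eq_re_inner v := by
    change ‖grad v‖ ^ 2 = RCLike.re ⟪grad v, grad v⟫
    exact norm_sq_eq_re_inner (𝕜 := ℝ) (grad v)
  conj_inner_symm u v := by
    change (starRingEnd ℝ) ⟪grad v, grad u⟫ = ⟪grad u, grad v⟫
    exact inner_conj_symm _ _
  add_left u v w := by
    change ⟪grad (u + v), grad w⟫ = ⟪grad u, grad w⟫ + ⟪grad v, grad w⟫
    rw [map_add, inner_add_left]
  smul_left u v c := by
    change ⟪grad (c • u), grad v⟫ = (starRingEnd ℝ) c * ⟪grad u, grad v⟫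
    rw [map_smul, inner_smul_left]

/-- The underlying `L²(Ω)` function. -/
def toL2 (v : X Ω Γ₁) : L2 Ω := H1.toL2 (toH1 v)

/-- The trace `γ v ∈ L²(∂Ω)`. -/
def tr (v : X Ω Γ₁) : L2Arc (frontier Ω) := trace Ω (toH1 v)

end X

/-- The bilinear form `a(u, v) = ξ (u, v)_X`. -/
def bilinearForm {Ω Γ₁ : Set Plane} (ξ : ℝ) (u v : X Ω Γ₁) : ℝ := ξ * ⟪u, v⟫

/-- The load functional `v ↦ ∫_Ω f₀ v dx + ∫_{Γ₂} f₂ γv dΓ`. -/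
def load {Ω Γ₁ Γ₂ : Set Plane} (f₀ : L2 Ω) (f₂ : L2Arc Γ₂) (v : X Ω Γ₁) : ℝ :=
  (∫ x in Ω, f₀ x * v.toL2 x) + ∫ x in Γ₂, f₂ x * v.tr x ∂μH[1]

/-- The friction functional `j(v) = ∫_{Γ₃} g |γv| dΓ`. -/
def friction {Ω Γ₁ : Set Plane} (Γ₃ : Set Plane) (g : ℝ) (v : X Ω Γ₁) : ℝ :=
  ∫ x in Γ₃, g * |v.tr x| ∂μH[1]

/-- The set of Lagrange multipliers: the elements of the topological dual of `X` bounded above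
by the friction functional. -/
def multipliers (Ω Γ₁ Γ₃ : Set Plane) (g : ℝ) : Set (StrongDual ℝ (X Ω Γ₁)) :=
  {μ | ∀ v : X Ω Γ₁, μ v ≤ friction Γ₃ g v}

/-- `(u, lam)` solves the mixed variational formulation with multiplier in the dual of `X`. -/
structure IsMixedSolution {Ω Γ₁ Γ₂ : Set Plane} (Γ₃ : Set Plane) (ξ g : ℝ) (f₀ : L2 Ω)
    (f₂ : L2Arc Γ₂) (u : X Ω Γ₁) (lam : StrongDual ℝ (X Ω Γ₁)) : Prop where
  equation : ∀ v : X Ω Γ₁, bilinearForm ξ u v + lam v = load f₀ f₂ v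
  inequality : ∀ μ ∈ multipliers Ω Γ₁ Γ₃ g, (μ - lam) u ≤ 0

end AntiplaneFriction

end

/-!
The space `X` with the norm `‖∇v‖` is a Hilbert space, the load functional is continuous on it, and
the set of multipliers is a closed convex subset of the dual that contains `0`. The equation gives
`ξ u` as the Riesz representative of `ℓ - lam`, where `ℓ` is the load functional; substituted in the
inequality, it says that `lam` is the metric projection of `ℓ` on the set of multipliers in the
Hilbert space dual to `X`. Existence and uniqueness are those of the projection
(`existsUnique_saddle`).

What has to be established is that a trace operator exists and that Friedrichs' inequality
`‖v‖_{H¹} ≤ C ‖∇v‖` holds on `X`; both rest on charts. In suitable orthonormal axes, `(s, t) ↦ (s, h s + t)`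
is area preserving, and near each point of its closure the domain is the image of a rectangle
`(a, b) × (0, d)`, whose bottom edge covers the boundary near that point (`exists_adapted_chart`).

* One-dimensional calculus on the vertical segments of the rectangle gives the trace inequality for
  smooth functions (`exists_trace_inequality`). It extends the restriction to the boundary
  continuously to the closure of the smooth functions in `H¹(Ω)`, and composition with an
  orthogonal projection gives a trace operator (`exists_isTraceOperator`).
* One-dimensional calculus on vertical and horizontal segments gives a Poincaré inequality on each
  chart, for smooth functions and, by mollification, for `H¹(Ω)`. Connectedness of `Ω` glues these
  into the Poincaré-Wirtinger inequality (`poincareWirtinger_self`).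
* For `v ∈ X` with `v - c` controlled by `∇v`, the trace of `v - c` is `-c` on `Γ₁`, so that
  continuity of the trace controls `c` as well (`exists_enorm_H1_sq_le`).
-/

namespace AntiplaneFriction

open Filter Topology Convolution

/-! ### Hilbert space lemmas -/

/-- The abstract saddle point problem. By Riesz, `u` is determined by `lam` through
`u = ξ⁻¹ (ℓ - lam)`, and the variational inequality for `u` then says exactly that `lam` is the
metric projection of `ℓ` on `K`. -/
theorem existsUnique_saddle {E : Type*} [NormedAddCommGroup E] [InnerProductSpace ℝ E]
    [CompleteSpace E] {K : Set (StrongDual ℝ E)} (hne : K.Nonempty) (hcl : IsClosed K)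
    (hcv : Convex ℝ K) {ξ : ℝ} (hξ : 0 < ξ) (ℓ : StrongDual ℝ E) :
    ∃! p : E × K, (∀ v, ξ * ⟪p.1, v⟫ + (p.2 : StrongDual ℝ E) v = ℓ v) ∧
      ∀ μ ∈ K, (μ - p.2) p.1 ≤ 0 := by
  -- The projection is taken in `E`, where `K'` corresponds to `K` and `y` to `ℓ`.
  set D := InnerProductSpace.toDual ℝ E with hD
  have hDa : ∀ x v, D x v = ⟪x, v⟫ := fun x v => by rw [hD, InnerProductSpace.toDual_apply_apply]
  set y := D.symm ℓ with hy
  have hDy : D y = ℓ := by simp [hy]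
  set K' : Set E := D ⁻¹' K with hK'
  have hcv' : Convex ℝ K' := by
    intro x hx z hz a b ha hb hab
    have := hcv hx hz ha hb hab
    simpa [hK', map_add] using this
  have hcl' : IsClosed K' := hcl.preimage D.continuous
  have hne' : K'.Nonempty := by
    obtain ⟨k, hk⟩ := hne
    exact ⟨D.symm k, by simpa [hK'] using hk⟩
  obtain ⟨x, hxK, hx⟩ := exists_norm_eq_iInf_of_complete_convex hne' hcl'.isComplete hcv' y
  rw [norm_eq_iInf_iff_real_inner_le_zero hcv' hxK] at hx
  refine ⟨(ξ⁻¹ • (y - x), ⟨D x, hxK⟩), ⟨fun v => ?_, fun μ hμ => ?_⟩, ?_⟩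
  · simp only [hDa]
    rw [← hDy, hDa, real_inner_smul_left, inner_sub_left]
    field_simp
    ring
  · have h1 := hx (D.symm μ) (by simpa [hK'] using hμ)
    have h2 : (μ - D x) (ξ⁻¹ • (y - x)) = ξ⁻¹ * ⟪y - x, D.symm μ - x⟫ := by
      have : μ - D x = D (D.symm μ - x) := by simp
      rw [this, hDa, real_inner_smul_right, real_inner_comm]
    change (μ - D x) (ξ⁻¹ • (y - x)) ≤ 0
    rw [h2]
    exact mul_nonpos_of_nonneg_of_nonpos (by positivity) h1
  · rintro ⟨u, lam, hlam⟩ ⟨h1, h2⟩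
    simp only at h1 h2
    obtain ⟨z, rfl⟩ := D.surjective lam
    have hu : ξ • u = y - z := by
      apply ext_inner_right ℝ
      intro v
      have := h1 v
      rw [hDa, ← hDy, hDa] at this
      rw [real_inner_smul_left, inner_sub_left]
      linarith
    have h3 : ⟪y - z, x - z⟫ ≤ 0 := by
      have := h2 (D x) hxK
      have e : (D x - D z) u = ⟪x - z, u⟫ := by rw [← map_sub, hDa]
      rw [e] at this
      rw [← hu, real_inner_smul_left, real_inner_comm]
      exact mul_nonpos_of_nonneg_of_nonpos hξ.le this
    have h4 := hx z hlam
    have h5 : ⟪x - z, x - z⟫ ≤ 0 := by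
      have e : ⟪x - z, x - z⟫ = ⟪y - z, x - z⟫ + ⟪y - x, z - x⟫ := by
        simp only [inner_sub_left, inner_sub_right]
        ring
      rw [e]; linarith
    have hxz : x = z := by
      rw [← sub_eq_zero]
      exact inner_self_eq_zero.1 (le_antisymm h5 real_inner_self_nonneg)
    subst hxz
    have hu' : u = ξ⁻¹ • (y - x) := by rw [← hu, smul_smul, inv_mul_cancel₀ hξ.ne', one_smul]
    subst hu'
    rfl

/-- A linear map `f` which is bounded with respect to `e` factors through `e` by a continuous linear
map. The range of `e` need not be dense: on its orthogonal complement the factor is zero. -/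
theorem exists_clm_extension {S H F : Type*} [AddCommGroup S] [Module ℝ S]
    [NormedAddCommGroup H] [InnerProductSpace ℝ H] [CompleteSpace H]
    [NormedAddCommGroup F] [NormedSpace ℝ F] [CompleteSpace F]
    (e : S →ₗ[ℝ] H) (f : S →ₗ[ℝ] F) {C : ℝ} (hC : ∀ x, ‖f x‖ ≤ C * ‖e x‖) :
    ∃ T : H →L[ℝ] F, ∀ x, T (e x) = f x := by
  let W : Submodule ℝ H := (LinearMap.range e).topologicalClosure
  have hW : ∀ x, e x ∈ W := fun x => Submodule.le_topologicalClosure _ ⟨x, rfl⟩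
  let e' : S →ₗ[ℝ] W := e.codRestrict W hW
  have hdense : DenseRange e' := by
    intro w
    rw [closure_subtype]
    have hw : (w : H) ∈ closure (LinearMap.range e : Set H) := w.2
    convert hw using 2
    ext z
    constructor
    · rintro ⟨_, ⟨x, rfl⟩, rfl⟩
      exact ⟨x, rfl⟩
    · rintro ⟨x, rfl⟩
      exact ⟨e' x, ⟨x, rfl⟩, rfl⟩
  have : CompleteSpace W := (Submodule.isClosed_topologicalClosure _).completeSpace_coe
  refine ⟨(f.extendOfNorm e').comp W.orthogonalProjectionOnto, fun x => ?_⟩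
  have h1 : W.orthogonalProjectionOnto (e x) = e' x :=
    Submodule.orthogonalProjectionOnto_mem_subspace_eq_self (K := W) (e' x)
  rw [ContinuousLinearMap.comp_apply, h1]
  exact LinearMap.extendOfNorm_eq hdense ⟨C, hC⟩ x

/-! ### Inequalities on intervals and rectangles -/

/-- The fundamental theorem of calculus combined with the Cauchy-Schwarz inequality. -/
theorem enorm_sub_sq_le_lintegral_deriv {f f' : ℝ → ℝ} (hf : ∀ t, HasDerivAt f (f' t) t)
    (hf' : Continuous f') {a b x y : ℝ} (hx : x ∈ Icc a b) (hy : y ∈ Icc a b) :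
    ‖f x - f y‖ₑ ^ 2 ≤ ENNReal.ofReal (b - a) * ∫⁻ t in Ioo a b, ‖f' t‖ₑ ^ 2 := by
  have hint : f x - f y = ∫ t in y..x, f' t :=
    (intervalIntegral.integral_eq_sub_of_hasDerivAt (fun t _ => hf t)
      (hf'.intervalIntegrable _ _)).symm
  have h1 : ‖f x - f y‖ₑ ≤ ∫⁻ t in Ioo a b, ‖f' t‖ₑ := by
    rw [hint, ← ofReal_norm, intervalIntegral.norm_intervalIntegral_eq, ofReal_norm]
    refine (enorm_integral_le_lintegral_enorm _).trans ?_
    rw [restrict_congr_set Ioo_ae_eq_Icc]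
    refine lintegral_mono_set ?_
    intro t ht
    rw [mem_uIoc] at ht
    constructor
    · rcases ht with h | h <;> linarith [hx.1, hy.1, h.1]
    · rcases ht with h | h <;> linarith [hx.2, hy.2, h.2]
  have h2 : ∫⁻ t in Ioo a b, ‖f' t‖ₑ ≤
      (∫⁻ t in Ioo a b, ‖f' t‖ₑ ^ 2) ^ (1 / 2 : ℝ) * (ENNReal.ofReal (b - a)) ^ (1 / 2 : ℝ) := by
    have := ENNReal.lintegral_mul_le_Lp_mul_Lq (volume.restrict (Ioo a b))
      (p := 2) (q := 2) (by constructor <;> norm_num)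
      (f := fun t => ‖f' t‖ₑ) (g := fun _ => 1) (by fun_prop) (by fun_prop)
    simpa using this
  calc ‖f x - f y‖ₑ ^ 2 ≤ ((∫⁻ t in Ioo a b, ‖f' t‖ₑ ^ 2) ^ (1 / 2 : ℝ) *
        (ENNReal.ofReal (b - a)) ^ (1 / 2 : ℝ)) ^ 2 := by gcongr; exact h1.trans h2
    _ = _ := by
      rw [mul_pow, ← ENNReal.rpow_natCast, ← ENNReal.rpow_natCast, ← ENNReal.rpow_mul,
        ← ENNReal.rpow_mul]
      norm_num [mul_comm]

theorem enorm_add_sq_le (x y : ℝ) : ‖x + y‖ₑ ^ 2 ≤ 2 * ‖x‖ₑ ^ 2 + 2 * ‖y‖ₑ ^ 2 := by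
  have h : ‖x + y‖ₑ ^ 2 ≤ (‖x‖ₑ + ‖y‖ₑ) ^ 2 := by gcongr; exact enorm_add_le x y
  refine h.trans ?_
  simp only [Real.enorm_eq_ofReal_abs]
  rw [← ENNReal.ofReal_add (abs_nonneg _) (abs_nonneg _), ← ENNReal.ofReal_pow (by positivity),
    ← ENNReal.ofReal_pow (by positivity), ← ENNReal.ofReal_pow (by positivity),
    show (2 : ENNReal) = ENNReal.ofReal 2 by simp, ← ENNReal.ofReal_mul (by norm_num),
    ← ENNReal.ofReal_mul (by norm_num), ← ENNReal.ofReal_add (by positivity) (by positivity)]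
  apply ENNReal.ofReal_le_ofReal
  nlinarith [sq_nonneg (|x| - |y|)]

/-- The Poincaré inequality on a rectangle, in the form of a double integral of differences: `z` and
`z'` are joined through a third corner, along one vertical and one horizontal segment. -/
theorem lintegral_lintegral_enorm_sub_sq_le_rectangle {f D₁ D₂ : ℝ × ℝ → ℝ}
    (h₁ : ∀ s t, HasDerivAt (fun s => f (s, t)) (D₁ (s, t)) s)
    (h₂ : ∀ s t, HasDerivAt (fun t => f (s, t)) (D₂ (s, t)) t)
    (c₁ : Continuous D₁) (c₂ : Continuous D₂)
    {a b c d l : ℝ} (hab : b - a ≤ l) (hcd : d - c ≤ l) :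
    ∫⁻ z in Ioo a b ×ˢ Ioo c d, ∫⁻ z' in Ioo a b ×ˢ Ioo c d, ‖f z - f z'‖ₑ ^ 2 ≤
      2 * ENNReal.ofReal l ^ 4 *
        ∫⁻ z in Ioo a b ×ˢ Ioo c d, (‖D₁ z‖ₑ ^ 2 + ‖D₂ z‖ₑ ^ 2) := by
  set L := ENNReal.ofReal l
  have hab' : ENNReal.ofReal (b - a) ≤ L := ENNReal.ofReal_le_ofReal hab
  have hcd' : ENNReal.ofReal (d - c) ≤ L := ENNReal.ofReal_le_ofReal hcd
  set R := Ioo a b ×ˢ Ioo c d with hR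
  have hRm : MeasurableSet R := measurableSet_Ioo.prod measurableSet_Ioo
  have hRv : volume R ≤ L * L := by
    rw [hR, volume_eq_prod, prod_prod, Real.volume_Ioo, Real.volume_Ioo]
    gcongr
  set G₁ : ℝ → ENNReal := fun t => ∫⁻ s in Ioo a b, ‖D₁ (s, t)‖ₑ ^ 2 with hG₁
  set G₂ : ℝ → ENNReal := fun s => ∫⁻ t in Ioo c d, ‖D₂ (s, t)‖ₑ ^ 2 with hG₂
  have mD₁ : Measurable (fun z => ‖D₁ z‖ₑ ^ 2) := by fun_prop
  have mD₂ : Measurable (fun z => ‖D₂ z‖ₑ ^ 2) := by fun_prop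
  have mG₁ : Measurable G₁ := mD₁.lintegral_prod_left'
  have mG₂ : Measurable G₂ := mD₂.lintegral_prod_right'
  have iG₁ : ∫⁻ z in R, G₁ z.2 = ENNReal.ofReal (b - a) * ∫⁻ z in R, ‖D₁ z‖ₑ ^ 2 := by
    rw [hR, volume_eq_prod, setLIntegral_prod _ (by fun_prop), setLIntegral_prod_symm _ (by fun_prop)]
    simp [G₁, mul_comm]
  have iG₂ : ∫⁻ z in R, G₂ z.1 = ENNReal.ofReal (d - c) * ∫⁻ z in R, ‖D₂ z‖ₑ ^ 2 := by
    rw [hR, volume_eq_prod, setLIntegral_prod _ (by fun_prop), setLIntegral_prod _ (by fun_prop)]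
    simp only [lintegral_const, restrict_apply_univ, Real.volume_Ioo]
    rw [lintegral_mul_const _ mG₂, mul_comm]
  have key : ∀ z ∈ R, ∀ z' ∈ R, ‖f z - f z'‖ₑ ^ 2 ≤ 2 * L * G₂ z.1 + 2 * L * G₁ z'.2 := by
    rintro ⟨s, t⟩ ⟨hs, ht⟩ ⟨s', t'⟩ ⟨hs', ht'⟩
    have e : f (s, t) - f (s', t') = (f (s, t) - f (s, t')) + (f (s, t') - f (s', t')) := by ring
    rw [e]
    refine (enorm_add_sq_le _ _).trans ?_
    rw [mul_assoc, mul_assoc]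
    gcongr
    · refine (enorm_sub_sq_le_lintegral_deriv (h₂ s) (by fun_prop) (Ioo_subset_Icc_self ht)
        (Ioo_subset_Icc_self ht')).trans ?_
      gcongr
    · refine (enorm_sub_sq_le_lintegral_deriv (fun u => h₁ u t') (by fun_prop)
        (Ioo_subset_Icc_self hs) (Ioo_subset_Icc_self hs')).trans ?_
      gcongr
  calc ∫⁻ z in R, ∫⁻ z' in R, ‖f z - f z'‖ₑ ^ 2
      ≤ ∫⁻ z in R, ∫⁻ z' in R, (2 * L * G₂ z.1 + 2 * L * G₁ z'.2) :=
        setLIntegral_mono' hRm fun z hz => setLIntegral_mono' hRm fun z' hz' => key z hz z' hz'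
    _ = ∫⁻ z in R, (2 * L * G₂ z.1 * volume R + 2 * L * ∫⁻ z in R, G₁ z.2) := by
        congr 1; ext z
        rw [lintegral_add_left (by fun_prop), lintegral_const, restrict_apply_univ,
          lintegral_const_mul _ (by fun_prop)]
    _ = 2 * L * (∫⁻ z in R, G₂ z.1) * volume R + 2 * L * (∫⁻ z in R, G₁ z.2) * volume R := by
        rw [lintegral_add_left (by fun_prop), lintegral_const, restrict_apply_univ,
          lintegral_mul_const _ (by fun_prop), lintegral_const_mul _ (by fun_prop)]
    _ ≤ 2 * L * (L * ∫⁻ z in R, ‖D₂ z‖ₑ ^ 2) * (L * L) +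
          2 * L * (L * ∫⁻ z in R, ‖D₁ z‖ₑ ^ 2) * (L * L) := by
        rw [iG₁, iG₂]; gcongr
    _ = 2 * L ^ 4 * ∫⁻ z in R, (‖D₁ z‖ₑ ^ 2 + ‖D₂ z‖ₑ ^ 2) := by
        rw [lintegral_add_left mD₁]; ring

/-- The trace inequality for the bottom edge of a rectangle. -/
theorem lintegral_enorm_sq_edge_le_rectangle {f D₂ : ℝ × ℝ → ℝ} (hf : Continuous f)
    (h₂ : ∀ s t, HasDerivAt (fun t => f (s, t)) (D₂ (s, t)) t) (c₂ : Continuous D₂)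
    {a b d : ℝ} (hd : 0 < d) :
    ENNReal.ofReal d * ∫⁻ s in Ioo a b, ‖f (s, 0)‖ₑ ^ 2 ≤
      2 * (∫⁻ z in Ioo a b ×ˢ Ioo 0 d, ‖f z‖ₑ ^ 2) +
        2 * ENNReal.ofReal d ^ 2 * ∫⁻ z in Ioo a b ×ˢ Ioo 0 d, ‖D₂ z‖ₑ ^ 2 := by
  set L := ENNReal.ofReal d with hL
  set G₂ : ℝ → ENNReal := fun s => ∫⁻ t in Ioo 0 d, ‖D₂ (s, t)‖ₑ ^ 2 with hG₂
  have mD₂ : Measurable (fun z => ‖D₂ z‖ₑ ^ 2) := by fun_prop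
  have mf : Measurable (fun z => ‖f z‖ₑ ^ 2) := by fun_prop
  have mfs : ∀ s, Measurable (fun t => ‖f (s, t)‖ₑ ^ 2) := fun s => mf.comp measurable_prodMk_left
  have mG₂ : Measurable G₂ := mD₂.lintegral_prod_right'
  have key : ∀ s, L * ‖f (s, 0)‖ₑ ^ 2 ≤
      2 * (∫⁻ t in Ioo 0 d, ‖f (s, t)‖ₑ ^ 2) + 2 * L ^ 2 * G₂ s := by
    intro s
    calc L * ‖f (s, 0)‖ₑ ^ 2 = ∫⁻ t in Ioo 0 d, ‖f (s, 0)‖ₑ ^ 2 := by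
          simp [hL, mul_comm]
      _ ≤ ∫⁻ t in Ioo 0 d, (2 * ‖f (s, t)‖ₑ ^ 2 + 2 * (L * G₂ s)) := by
          refine setLIntegral_mono' measurableSet_Ioo fun t ht => ?_
          have e : f (s, 0) = f (s, t) + (f (s, 0) - f (s, t)) := by ring
          rw [e]
          refine (enorm_add_sq_le _ _).trans ?_
          gcongr
          refine (enorm_sub_sq_le_lintegral_deriv (h₂ s) (by fun_prop) (left_mem_Icc.2 hd.le)
            (Ioo_subset_Icc_self ht)).trans ?_
          rw [sub_zero]
      _ = _ := by
          rw [lintegral_add_left ((mfs s).const_mul _), lintegral_const_mul _ (mfs s)]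
          simp only [lintegral_const, restrict_apply_univ, Real.volume_Ioo, sub_zero, ← hL]
          ring
  calc L * ∫⁻ s in Ioo a b, ‖f (s, 0)‖ₑ ^ 2 = ∫⁻ s in Ioo a b, L * ‖f (s, 0)‖ₑ ^ 2 := by
        rw [lintegral_const_mul' _ _ ENNReal.ofReal_ne_top]
    _ ≤ ∫⁻ s in Ioo a b, (2 * (∫⁻ t in Ioo 0 d, ‖f (s, t)‖ₑ ^ 2) + 2 * L ^ 2 * G₂ s) :=
        lintegral_mono key
    _ = _ := by
        rw [lintegral_add_right _ (by fun_prop), lintegral_const_mul _ mf.lintegral_prod_right',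
          lintegral_const_mul _ mG₂, volume_eq_prod, setLIntegral_prod _ (by fun_prop),
          setLIntegral_prod _ (by fun_prop)]

/-! ### Graph charts -/

/-- Coordinates that straighten the graph of `h`: in the axes given by the linear isometry `e`, the
pair `(s, t)` is sent to the point at height `t` above the graph of `h` over `s`. This homeomorphism
preserves area, whatever the continuous function `h`. -/
noncomputable def graphChart (e : Plane ≃ₗᵢ[ℝ] Plane) {h : ℝ → ℝ} (hh : Continuous h) : ℝ × ℝ ≃ₜ Plane where
  toFun z := e.symm (WithLp.toLp 2 ![z.1, h z.1 + z.2])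
  invFun x := (e x 0, e x 1 - h (e x 0))
  left_inv z := by simp
  right_inv x := by
    apply e.injective
    ext i
    fin_cases i <;> simp
  continuous_toFun := by
    refine e.symm.continuous.comp ((PiLp.continuous_toLp 2 _).comp ?_)
    refine continuous_pi fun i => ?_
    fin_cases i
    · exact continuous_fst
    · exact (hh.comp continuous_fst).add continuous_snd
  continuous_invFun := by fun_prop

section graphChart

variable {e : Plane ≃ₗᵢ[ℝ] Plane} {h : ℝ → ℝ} (hh : Continuous h)

theorem graphChart_symm_apply (x : Plane) :
    (graphChart e hh).symm x = (e x 0, e x 1 - h (e x 0)) := rfl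

theorem measurePreserving_graphChart : MeasurePreserving (graphChart e hh) volume volume := by
  have h1 : MeasurePreserving (fun z : ℝ × ℝ => (z.1, h z.1 + z.2)) volume volume := by
    rw [volume_eq_prod]
    refine MeasurePreserving.skew_product (f := id) (g := fun s t => h s + t)
      (MeasurePreserving.id _) ?_ (Filter.Eventually.of_forall fun s => ?_)
    · exact ((hh.comp continuous_fst).add continuous_snd).measurable
    · exact (measurePreserving_add_left volume (h s)).map_eq
  have h2 : MeasurePreserving (MeasurableEquiv.finTwoArrow (α := ℝ)).symm volume volume :=
    (volume_preserving_finTwoArrow ℝ).symm _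
  have h3 := ((e.symm.measurePreserving.comp (PiLp.volume_preserving_toLp (Fin 2))).comp h2).comp h1
  exact h3

theorem setLIntegral_graphChart (f : Plane → ENNReal) (s : Set (ℝ × ℝ)) :
    ∫⁻ x in graphChart e hh '' s, f x = ∫⁻ z in s, f (graphChart e hh z) :=
  ((measurePreserving_graphChart hh).setLIntegral_comp_emb
    (graphChart e hh).measurableEmbedding f s).symm

/-- The image of the first coordinate direction under the derivative of `graphChart e hh`. -/
noncomputable def graphTangent (e : Plane ≃ₗᵢ[ℝ] Plane) (h : ℝ → ℝ) (s : ℝ) : Plane :=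
  e.symm (WithLp.toLp 2 ![1, deriv h s])

theorem hasDerivAt_toLp_pair {f g : ℝ → ℝ} {f' g' s : ℝ} (hf : HasDerivAt f f' s)
    (hg : HasDerivAt g g' s) :
    HasDerivAt (fun s => e.symm (WithLp.toLp 2 ![f s, g s])) (e.symm (WithLp.toLp 2 ![f', g'])) s := by
  have h1 : HasDerivAt (fun s => (![f s, g s] : Fin 2 → ℝ)) ![f', g'] s := by
    rw [hasDerivAt_pi]
    intro i
    fin_cases i
    · exact hf
    · exact hg
  have h2 := ((e.symm.toContinuousLinearEquiv.toContinuousLinearMap).comp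
    ((PiLp.continuousLinearEquiv 2 ℝ (fun _ : Fin 2 => ℝ)).symm.toContinuousLinearMap)).hasFDerivAt.comp_hasDerivAt
      s h1
  exact h2

theorem hasDerivAt_graphChart_fst (hd : Differentiable ℝ h) (s t : ℝ) :
    HasDerivAt (fun s => graphChart e hh (s, t)) (graphTangent e h s) s :=
  hasDerivAt_toLp_pair (hasDerivAt_id s) ((hd s).hasDerivAt.add_const t)

theorem hasDerivAt_graphChart_snd (s t : ℝ) :
    HasDerivAt (fun t => graphChart e hh (s, t)) (e.symm (WithLp.toLp 2 ![0, 1])) t :=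
  hasDerivAt_toLp_pair (hasDerivAt_const t s) ((hasDerivAt_id t).const_add (h s))

theorem norm_toLp_pair_le (x y : ℝ) : ‖e.symm (WithLp.toLp 2 ![x, y])‖ ≤ |x| + |y| := by
  rw [e.symm.norm_map, EuclideanSpace.norm_eq]
  apply Real.sqrt_le_iff.2
  constructor
  · positivity
  · simp
    nlinarith [abs_nonneg x, abs_nonneg y, sq_abs x, sq_abs y]

theorem continuous_graphTangent (hd : Continuous (deriv h)) : Continuous (graphTangent e h) := by
  refine e.symm.continuous.comp ((PiLp.continuous_toLp 2 _).comp ?_)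
  refine continuous_pi fun i => ?_
  fin_cases i
  · exact continuous_const
  · exact hd

end graphChart

theorem exists_deriv_bound {h : ℝ → ℝ} (hh : ContDiff ℝ ∞ h) (a b : ℝ) :
    ∃ M : ℝ, 0 ≤ M ∧ ∀ s ∈ Icc a b, |deriv h s| ≤ M := by
  obtain ⟨M, hM⟩ := isCompact_Icc.exists_bound_of_continuousOn (s := Icc a b)
    (hh.continuous_deriv (by simp)).continuousOn
  exact ⟨max M 0, le_max_right _ _, fun s hs => (hM s hs).trans (le_max_left _ _)⟩

/-- The Poincaré inequality for smooth functions on the image of a rectangle under a chart. The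
constant depends on the rectangle only through a bound `l` for its sides, so that it serves for all
smaller rectangles too. -/
theorem lintegral_lintegral_enorm_sub_sq_le_graphChart {e : Plane ≃ₗᵢ[ℝ] Plane} {h : ℝ → ℝ}
    (hh : ContDiff ℝ ∞ h) {w : Plane → ℝ} (hw : ContDiff ℝ ∞ w) {a b c d l M : ℝ}
    (hab : b - a ≤ l) (hcd : d - c ≤ l) (hM0 : 0 ≤ M) (hM : ∀ s ∈ Icc a b, |deriv h s| ≤ M) :
    ∫⁻ x in graphChart e hh.continuous '' (Ioo a b ×ˢ Ioo c d),
      ∫⁻ y in graphChart e hh.continuous '' (Ioo a b ×ˢ Ioo c d), ‖w x - w y‖ₑ ^ 2 ≤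
      4 * ENNReal.ofReal l ^ 4 * ENNReal.ofReal (1 + M) ^ 2 *
        ∫⁻ x in graphChart e hh.continuous '' (Ioo a b ×ˢ Ioo c d), ‖fderiv ℝ w x‖ₑ ^ 2 := by
  simp only [setLIntegral_graphChart]
  have hdw : Continuous (fderiv ℝ w) := hw.continuous_fderiv (by simp)
  have hdd : Differentiable ℝ h := hh.differentiable (by simp)
  have hwd : Differentiable ℝ w := hw.differentiable (by simp)
  have hct : Continuous (graphTangent e h) := continuous_graphTangent (hh.continuous_deriv (by simp))
  set Φ := graphChart e hh.continuous with hΦ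
  have hΦc : Continuous Φ := Φ.continuous
  refine (lintegral_lintegral_enorm_sub_sq_le_rectangle (f := fun z => w (Φ z))
    (D₁ := fun z => fderiv ℝ w (Φ z) (graphTangent e h z.1))
    (D₂ := fun z => fderiv ℝ w (Φ z) (e.symm (WithLp.toLp 2 ![0, 1]))) ?_ ?_ ?_ ?_ hab hcd).trans ?_
  · intro s t
    exact (hwd _).hasFDerivAt.comp_hasDerivAt s (hasDerivAt_graphChart_fst hh.continuous hdd s t)
  · intro s t
    exact (hwd _).hasFDerivAt.comp_hasDerivAt t (hasDerivAt_graphChart_snd hh.continuous s t)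
  · exact (hdw.comp hΦc).clm_apply (hct.comp continuous_fst)
  · exact (hdw.comp hΦc).clm_apply continuous_const
  · have hle : ∀ (z : ℝ × ℝ) (v : Plane), ‖v‖ ≤ 1 + M →
        ‖fderiv ℝ w (Φ z) v‖ₑ ^ 2 ≤ ENNReal.ofReal (1 + M) ^ 2 * ‖fderiv ℝ w (Φ z)‖ₑ ^ 2 := by
      intro z v hv
      rw [← mul_pow]
      gcongr
      rw [← ofReal_norm, ← ofReal_norm, ← ENNReal.ofReal_mul (by positivity)]
      apply ENNReal.ofReal_le_ofReal
      rw [mul_comm]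
      exact (ContinuousLinearMap.le_opNorm _ _).trans (by gcongr)
    have e1 : ∫⁻ z in Ioo a b ×ˢ Ioo c d, (‖fderiv ℝ w (Φ z) (graphTangent e h z.1)‖ₑ ^ 2 +
          ‖fderiv ℝ w (Φ z) (e.symm (WithLp.toLp 2 ![0, 1]))‖ₑ ^ 2) ≤
        ∫⁻ z in Ioo a b ×ˢ Ioo c d,
          (2 * ENNReal.ofReal (1 + M) ^ 2) * ‖fderiv ℝ w (Φ z)‖ₑ ^ 2 := by
      refine setLIntegral_mono' (measurableSet_Ioo.prod measurableSet_Ioo) fun z hz => ?_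
      rw [mul_assoc, two_mul]
      refine add_le_add (hle z _ ?_) (hle z _ ?_)
      · refine (norm_toLp_pair_le _ _).trans ?_
        simpa using hM z.1 (Ioo_subset_Icc_self hz.1)
      · refine (norm_toLp_pair_le _ _).trans ?_
        simpa using hM0
    refine (mul_le_mul_right e1 _).trans ?_
    rw [lintegral_const_mul' _ _ (by finiteness)]
    apply le_of_eq
    ring

/-! ### Mollification and the Poincaré inequality on a chart -/

theorem enorm_sq_eq_sum (y : Plane) : ‖y‖ₑ ^ 2 = ∑ i, ‖y i‖ₑ ^ 2 := by
  have h := EuclideanSpace.norm_sq_eq y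
  simp only [← ofReal_norm, ← ENNReal.ofReal_pow (norm_nonneg _)]
  rw [h, ENNReal.ofReal_sum_of_nonneg fun i _ => by positivity]

theorem gradient_apply_eq_partialDeriv (φ : Plane → ℝ) (x : Plane) (i : Fin 2) :
    gradient φ x i = partialDeriv i φ x := by
  have h : ⟪gradient φ x, EuclideanSpace.single i 1⟫ = partialDeriv i φ x := by
    rw [gradient, InnerProductSpace.toDual_symm_apply]
    rfl
  rw [← h, EuclideanSpace.inner_single_right]
  simp

theorem enorm_fderiv_eq_enorm_gradient (φ : Plane → ℝ) (x : Plane) :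
    ‖fderiv ℝ φ x‖ₑ = ‖gradient φ x‖ₑ := by
  rw [gradient, LinearIsometryEquiv.enorm_map]

/-- Young's inequality `‖r ⋆ q‖_{L²} ≤ ‖r‖_{L¹} ‖q‖_{L²}` for a kernel `r` of mass one. -/
theorem lintegral_sq_lintegral_sub_mul_le {r q : Plane → ENNReal} (hr : Measurable r)
    (hq : Measurable q) (h1 : ∫⁻ x, r x = 1) :
    ∫⁻ x, (∫⁻ y, r (x - y) * q y) ^ 2 ≤ ∫⁻ y, q y ^ 2 := by
  have hm : Measurable (fun z : Plane × Plane => r (z.1 - z.2) * q z.2 ^ 2) := by fun_prop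
  have key : ∀ x, (∫⁻ y, r (x - y) * q y) ^ 2 ≤ ∫⁻ y, r (x - y) * q y ^ 2 := by
    intro x
    have h := ENNReal.lintegral_mul_le_Lp_mul_Lq (volume : Measure Plane)
      (p := 2) (q := 2) (by constructor <;> norm_num)
      (f := fun y => r (x - y) ^ (1 / 2 : ℝ)) (g := fun y => r (x - y) ^ (1 / 2 : ℝ) * q y)
      (by fun_prop) (by fun_prop)
    have e1 : ∀ y, r (x - y) ^ (1 / 2 : ℝ) * (r (x - y) ^ (1 / 2 : ℝ) * q y) = r (x - y) * q y := by
      intro y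
      rw [← mul_assoc, ← ENNReal.rpow_add_of_nonneg _ _ (by norm_num) (by norm_num)]
      norm_num
    have e2 : ∀ y, (r (x - y) ^ (1 / 2 : ℝ) * q y) ^ (2 : ℝ) = r (x - y) * q y ^ 2 := by
      intro y
      rw [ENNReal.mul_rpow_of_nonneg _ _ (by norm_num), ← ENNReal.rpow_mul]
      norm_num
    have e3 : ∀ y, (r (x - y) ^ (1 / 2 : ℝ)) ^ (2 : ℝ) = r (x - y) := by
      intro y
      rw [← ENNReal.rpow_mul]; norm_num
    simp only [Pi.mul_apply, e1, e2, e3, lintegral_sub_left_eq_self, h1, ENNReal.one_rpow,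
      one_mul] at h
    calc (∫⁻ y, r (x - y) * q y) ^ 2 ≤ ((∫⁻ y, r (x - y) * q y ^ 2) ^ (1 / 2 : ℝ)) ^ 2 := by gcongr
      _ = _ := by
        rw [← ENNReal.rpow_natCast, ← ENNReal.rpow_mul]; norm_num
  calc ∫⁻ x, (∫⁻ y, r (x - y) * q y) ^ 2 ≤ ∫⁻ x, ∫⁻ y, r (x - y) * q y ^ 2 := lintegral_mono key
    _ = ∫⁻ y, ∫⁻ x, r (x - y) * q y ^ 2 := lintegral_lintegral_swap hm.aemeasurable
    _ = ∫⁻ y, q y ^ 2 := by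
      congr 1; ext y
      rw [lintegral_mul_const _ (by fun_prop), lintegral_sub_right_eq_self r, h1, one_mul]

variable {Ω : Set Plane}

theorem measurable_grad_apply (v : H1 Ω) (i : Fin 2) : Measurable (fun x => H1.grad v x i) := by
  have h := (Lp.stronglyMeasurable (H1.grad v)).measurable
  exact (EuclideanSpace.proj (𝕜 := ℝ) i : Plane →L[ℝ] ℝ).measurable.comp h

/-- Differentiation commutes with mollification of an `H¹(Ω)` function at the points `x` for which
`y ↦ ρ (x - y)` is a test function in `Ω`. -/
theorem partialDeriv_convolution_eq (hΩ : IsOpen Ω) (v : H1 Ω) {ρ : Plane → ℝ}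
    (hρ : ContDiff ℝ ∞ ρ) (hc : HasCompactSupport ρ) {x : Plane}
    (hx : tsupport (fun y => ρ (x - y)) ⊆ Ω) (i : Fin 2) :
    partialDeriv i (ρ ⋆ Ω.indicator (H1.toL2 v)) x = ∫ y in Ω, H1.grad v y i * ρ (x - y) := by
  set u := Ω.indicator (H1.toL2 v) with hu
  have hul : LocallyIntegrable u := by
    refine MemLp.locallyIntegrable (p := 2) ?_ (by norm_num)
    exact (memLp_indicator_iff_restrict hΩ.measurableSet).2 (Lp.memLp _)
  have hD := (hc.hasFDerivAt_convolution_left (ContinuousLinearMap.lsmul ℝ ℝ)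
    (hρ.of_le (by simp)) hul x).fderiv
  have hint := hc.fderiv ℝ |>.convolutionExists_left
    (ContinuousLinearMap.precompL Plane (ContinuousLinearMap.lsmul ℝ ℝ (E := ℝ)))
    (hρ.continuous_fderiv (by simp)) hul x
  have hψ : ContDiff ℝ ∞ (fun y => ρ (x - y)) := hρ.comp (contDiff_const.sub contDiff_id)
  have hψc : HasCompactSupport (fun y => ρ (x - y)) :=
    hc.comp_homeomorph (Homeomorph.subLeft x)
  have hψd : ∀ y, partialDeriv i (fun y => ρ (x - y)) y =
      - fderiv ℝ ρ (x - y) (EuclideanSpace.single i 1) := by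
    intro y
    have h1 : HasFDerivAt (fun y => ρ (x - y))
        ((fderiv ℝ ρ (x - y)).comp (-ContinuousLinearMap.id ℝ Plane)) y :=
      HasFDerivAt.comp y ((hρ.differentiable (by simp)) (x - y)).hasFDerivAt
        ((hasFDerivAt_id y).const_sub x)
    rw [partialDeriv, h1.fderiv]
    simp
  have hw : ∫ y in Ω, H1.toL2 v y * partialDeriv i (fun y => ρ (x - y)) y =
      -∫ y in Ω, H1.grad v y i * ρ (x - y) := v.2 _ hψ hψc hx i
  rw [partialDeriv, hD, convolution_eq_swap, ContinuousLinearMap.integral_apply]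
  · rw [← neg_inj, ← hw, ← integral_indicator hΩ.measurableSet, ← integral_neg]
    congr 1; ext y
    simp only [hψd]
    by_cases hy : y ∈ Ω
    · simp [hu, hy, H1.toL2, mul_comm]
    · simp [hu, hy]
  · exact hint.integrable_swap

/-- On a compact subset of `Ω`, an element of `H¹(Ω)` is the almost everywhere limit of smooth
functions with no more gradient energy: its mollifications. -/
theorem exists_smooth_approx (hΩ : IsOpen Ω) (v : H1 Ω) {K : Set Plane} (hK : IsCompact K)
    (hKΩ : K ⊆ Ω) :
    ∃ w : ℕ → Plane → ℝ, (∀ n, ContDiff ℝ ∞ (w n)) ∧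
      (∀ᵐ x ∂volume.restrict Ω, Tendsto (fun n => w n x) atTop (𝓝 (H1.toL2 v x))) ∧
      ∀ n, ∫⁻ x in K, ‖fderiv ℝ (w n) x‖ₑ ^ 2 ≤ ∫⁻ x in Ω, ‖H1.grad v x‖ₑ ^ 2 := by
  obtain ⟨δ, hδ, hδΩ⟩ := hK.exists_cthickening_subset_open hΩ hKΩ
  have hpos : ∀ n : ℕ, 0 < δ / (n + 1) := fun n => by positivity
  let φ : ℕ → ContDiffBump (0 : Plane) := fun n =>
    ⟨δ / (n + 1) / 2, δ / (n + 1), half_pos (hpos n), half_lt_self (hpos n)⟩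
  set u := Ω.indicator (H1.toL2 v) with hu
  have hul : LocallyIntegrable u := by
    refine MemLp.locallyIntegrable (p := 2) ?_ (by norm_num)
    exact (memLp_indicator_iff_restrict hΩ.measurableSet).2 (Lp.memLp _)
  refine ⟨fun n => (φ n).normed volume ⋆ u, fun n => ?_, ?_, fun n => ?_⟩
  · exact (φ n).hasCompactSupport_normed.contDiff_convolution_left _ (φ n).contDiff_normed hul
  · have h0 : Tendsto (fun n => (φ n).rOut) atTop (𝓝 0) := by
      change Tendsto (fun n : ℕ => δ / ((n : ℝ) + 1)) atTop (𝓝 0)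
      exact tendsto_const_div_atTop_nhds_zero_nat δ |>.comp (tendsto_add_atTop_nat 1) |>.congr
        fun n => by simp
    have h1 : ∀ᶠ n in atTop, (φ n).rOut ≤ 2 * (φ n).rIn := by
      refine Eventually.of_forall fun n => ?_
      change δ / ((n : ℝ) + 1) ≤ 2 * (δ / (n + 1) / 2)
      linarith
    have h2 := ContDiffBump.ae_convolution_tendsto_right_of_locallyIntegrable h0 h1 hul
    filter_upwards [ae_restrict_of_ae h2, ae_restrict_mem hΩ.measurableSet] with x hx hxΩ
    rwa [hu, indicator_of_mem hxΩ] at hx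
  · set ρ := (φ n).normed volume with hρ
    have hρc : Continuous ρ := (φ n).continuous_normed
    set r : Plane → ENNReal := fun x => ‖ρ x‖ₑ with hr
    have hr1 : ∫⁻ x, r x = 1 := by
      have h := (φ n).integral_normed (μ := (volume : Measure Plane))
      have h2 := ofReal_integral_eq_lintegral_ofReal ((φ n).integrable_normed (μ := volume))
        (Eventually.of_forall fun x => (φ n).nonneg_normed x)
      rw [h] at h2
      rw [← ENNReal.ofReal_one, h2]
      congr 1; ext x
      rw [hr]; simp only
      rw [Real.enorm_of_nonneg ((φ n).nonneg_normed x)]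
    have hcomp : ∀ x ∈ K, ∀ i, ‖partialDeriv i (ρ ⋆ u) x‖ₑ ^ 2 ≤
        (∫⁻ y, r (x - y) * ‖Ω.indicator (fun y => H1.grad v y i) y‖ₑ) ^ 2 := by
      intro x hx i
      have hsub : tsupport (fun y => ρ (x - y)) ⊆ Ω := by
        refine Subset.trans ?_ hδΩ
        refine closure_minimal ?_ Metric.isClosed_cthickening
        intro y hy
        have h1 : x - y ∈ Function.support ρ := hy
        rw [hρ, ContDiffBump.support_normed_eq, Metric.mem_ball, dist_zero_right] at h1
        refine Metric.mem_cthickening_of_dist_le y x δ K hx ?_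
        rw [dist_comm, dist_eq_norm]
        refine h1.le.trans ?_
        change δ / ((n : ℝ) + 1) ≤ δ
        exact div_le_self hδ.le (by linarith [n.cast_nonneg (α := ℝ)])
      rw [partialDeriv_convolution_eq hΩ v (φ n).contDiff_normed
        (φ n).hasCompactSupport_normed hsub i]
      gcongr
      refine (enorm_integral_le_lintegral_enorm _).trans ?_
      rw [← lintegral_indicator hΩ.measurableSet]
      refine lintegral_mono fun y => ?_
      by_cases hy : y ∈ Ω
      · simp [hy, hr, hρ, enorm_mul, mul_comm]
      · simp [hy]
    calc ∫⁻ x in K, ‖fderiv ℝ (ρ ⋆ u) x‖ₑ ^ 2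
        ≤ ∫⁻ x in K, ∑ i, (∫⁻ y, r (x - y) * ‖Ω.indicator (fun y => H1.grad v y i) y‖ₑ) ^ 2 := by
          refine setLIntegral_mono' hK.measurableSet fun x hx => ?_
          rw [enorm_fderiv_eq_enorm_gradient, enorm_sq_eq_sum]
          refine Finset.sum_le_sum fun i _ => ?_
          rw [gradient_apply_eq_partialDeriv]
          exact hcomp x hx i
      _ ≤ ∫⁻ x, ∑ i, (∫⁻ y, r (x - y) * ‖Ω.indicator (fun y => H1.grad v y i) y‖ₑ) ^ 2 :=
          setLIntegral_le_lintegral _ _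
      _ = ∑ i, ∫⁻ x, (∫⁻ y, r (x - y) * ‖Ω.indicator (fun y => H1.grad v y i) y‖ₑ) ^ 2 := by
          refine lintegral_finsetSum _ fun i _ => ?_
          refine Measurable.pow_const ?_ _
          refine Measurable.lintegral_prod_right'
            (f := fun z : Plane × Plane =>
              r (z.1 - z.2) * ‖Ω.indicator (fun y => H1.grad v y i) z.2‖ₑ) ?_
          have := (measurable_grad_apply v i).indicator hΩ.measurableSet
          fun_prop
      _ ≤ ∑ i, ∫⁻ y, ‖Ω.indicator (fun y => H1.grad v y i) y‖ₑ ^ 2 := by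
          refine Finset.sum_le_sum fun i _ => ?_
          refine lintegral_sq_lintegral_sub_mul_le (by fun_prop) ?_ hr1
          exact ((measurable_grad_apply v i).indicator hΩ.measurableSet).enorm
      _ = ∑ i, ∫⁻ y in Ω, ‖H1.grad v y i‖ₑ ^ 2 := by
          congr 1; ext i
          rw [← lintegral_indicator hΩ.measurableSet]
          congr 1; ext y
          by_cases hy : y ∈ Ω <;> simp [hy]
      _ = ∫⁻ x in Ω, ‖H1.grad v x‖ₑ ^ 2 := by
          rw [← lintegral_finsetSum _ fun i _ => (measurable_grad_apply v i).enorm.pow_const 2]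
          simp only [enorm_sq_eq_sum]

/-- The Poincaré inequality for `H¹(Ω)` functions on the image of a rectangle under a chart. The
closed rectangle may touch the boundary of `Ω`: the inequality passes by Fatou's lemma from smooth
functions to `H¹(Ω)` on smaller rectangles with closure in `Ω`, and by monotone convergence to the
whole rectangle. -/
theorem lintegral_lintegral_enorm_toL2_sub_sq_le_graphChart (hΩ : IsOpen Ω)
    {e : Plane ≃ₗᵢ[ℝ] Plane} {h : ℝ → ℝ}
    (hh : ContDiff ℝ ∞ h) {a b d l M : ℝ} (hab : b - a ≤ l) (hdl : d ≤ l) (hM0 : 0 ≤ M)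
    (hM : ∀ s ∈ Icc a b, |deriv h s| ≤ M)
    (hsub : graphChart e hh.continuous '' (Ioo a b ×ˢ Ioo 0 d) ⊆ Ω) (v : H1 Ω) :
    ∫⁻ x in graphChart e hh.continuous '' (Ioo a b ×ˢ Ioo 0 d),
      ∫⁻ y in graphChart e hh.continuous '' (Ioo a b ×ˢ Ioo 0 d),
        ‖H1.toL2 v x - H1.toL2 v y‖ₑ ^ 2 ≤
      4 * ENNReal.ofReal l ^ 4 * ENNReal.ofReal (1 + M) ^ 2 *
        ∫⁻ x in Ω, ‖H1.grad v x‖ₑ ^ 2 := by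
  set C := 4 * ENNReal.ofReal l ^ 4 * ENNReal.ofReal (1 + M) ^ 2 *
        ∫⁻ x in Ω, ‖H1.grad v x‖ₑ ^ 2 with hC
  set Φ := graphChart e hh.continuous with hΦ
  let R : ℕ → Set (ℝ × ℝ) := fun n =>
    Ioo (a + 1 / (n + 1)) (b - 1 / (n + 1)) ×ˢ Ioo (0 + 1 / ((n : ℝ) + 1)) (d - 1 / (n + 1))
  have hRo : ∀ n, IsOpen (Φ '' R n) := fun n => Φ.isOpenMap _ (isOpen_Ioo.prod isOpen_Ioo)
  have hpos : ∀ n : ℕ, 0 < 1 / ((n : ℝ) + 1) := fun n => by positivity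
  have hmono : Monotone fun n => Φ '' R n := by
    intro m n hmn
    have : 1 / ((n : ℝ) + 1) ≤ 1 / ((m : ℝ) + 1) :=
      one_div_le_one_div_of_le (by positivity) (by gcongr)
    refine image_mono (prod_mono (Ioo_subset_Ioo ?_ ?_) (Ioo_subset_Ioo ?_ ?_)) <;> linarith
  have hU : Φ '' (Ioo a b ×ˢ Ioo 0 d) = ⋃ n, Φ '' R n := by
    rw [← image_iUnion]
    congr 1
    ext ⟨s, t⟩
    simp only [mem_prod, mem_Ioo, mem_iUnion, R]
    constructor
    · rintro ⟨⟨h1, h2⟩, h3, h4⟩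
      obtain ⟨n, hn⟩ := exists_nat_one_div_lt
        (show 0 < min (min (s - a) (b - s)) (min t (d - t)) by simp [h1, h2, h3, h4])
      simp only [lt_min_iff] at hn
      exact ⟨n, by constructor <;> constructor <;> linarith [hn.1.1, hn.1.2, hn.2.1, hn.2.2]⟩
    · rintro ⟨n, ⟨h1, h2⟩, h3, h4⟩
      have := hpos n
      constructor <;> constructor <;> linarith
  -- The closure of `Φ '' R n` is a compact subset of `Ω`, so mollification applies there.
  have step : ∀ n, ∫⁻ x in Φ '' R n, ∫⁻ y in Φ '' R n, ‖H1.toL2 v x - H1.toL2 v y‖ₑ ^ 2 ≤ C := by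
    intro n
    have hn := hpos n
    set K : Set Plane := Φ '' (Icc (a + 1 / (n + 1)) (b - 1 / (n + 1)) ×ˢ
      Icc (0 + 1 / ((n : ℝ) + 1)) (d - 1 / (n + 1))) with hKdef
    have hK : IsCompact K := (isCompact_Icc.prod isCompact_Icc).image Φ.continuous
    have hKΩ : K ⊆ Ω := by
      refine Subset.trans (image_mono (prod_mono ?_ ?_)) hsub
      · exact Icc_subset_Ioo (by linarith) (by linarith)
      · exact Icc_subset_Ioo (by linarith) (by linarith)
    have hRK : Φ '' R n ⊆ K := image_mono (prod_mono Ioo_subset_Icc_self Ioo_subset_Icc_self)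
    obtain ⟨w, hw, hlim, hgrad⟩ := exists_smooth_approx hΩ v hK hKΩ
    have hlim' := ae_restrict_of_ae_restrict_of_subset (hRK.trans hKΩ) hlim
    have hbound : ∀ k, ∫⁻ x in Φ '' R n, ∫⁻ y in Φ '' R n, ‖w k x - w k y‖ₑ ^ 2 ≤ C := by
      intro k
      refine (lintegral_lintegral_enorm_sub_sq_le_graphChart hh (hw k) (l := l) (by linarith)
        (by linarith) hM0 ?_).trans ?_
      · intro s hs
        exact hM s ⟨by linarith [hs.1], by linarith [hs.2]⟩
      · rw [hC]
        exact mul_le_mul_right ((lintegral_mono_set hRK).trans (hgrad k)) _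
    have hwm : ∀ k, Measurable (fun z : Plane × Plane => ‖w k z.1 - w k z.2‖ₑ ^ 2) := by
      intro k
      have := (hw k).continuous
      fun_prop
    calc ∫⁻ x in Φ '' R n, ∫⁻ y in Φ '' R n, ‖H1.toL2 v x - H1.toL2 v y‖ₑ ^ 2
        = ∫⁻ x in Φ '' R n, ∫⁻ y in Φ '' R n, liminf (fun k => ‖w k x - w k y‖ₑ ^ 2) atTop := by
          refine lintegral_congr_ae ?_
          filter_upwards [hlim'] with x hx
          refine lintegral_congr_ae ?_
          filter_upwards [hlim'] with y hy
          exact ((((ENNReal.continuous_pow 2).tendsto _).comp (hx.sub hy).enorm).liminf_eq).symm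
      _ ≤ ∫⁻ x in Φ '' R n, liminf (fun k => ∫⁻ y in Φ '' R n, ‖w k x - w k y‖ₑ ^ 2) atTop := by
          refine lintegral_mono fun x => lintegral_liminf_le fun k => ?_
          exact (hwm k).comp measurable_prodMk_left
      _ ≤ liminf (fun k => ∫⁻ x in Φ '' R n, ∫⁻ y in Φ '' R n, ‖w k x - w k y‖ₑ ^ 2) atTop :=
          lintegral_liminf_le fun k => (hwm k).lintegral_prod_right'
      _ ≤ C := by
          refine liminf_le_of_le (by isBoundedDefault) fun c hc => ?_
          obtain ⟨k, hk⟩ := hc.exists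
          exact hk.trans (hbound k)
  rw [hU, setLIntegral_iUnion_of_directed _ hmono.directed_le]
  refine iSup_le fun m => ?_
  have hvm : Measurable (fun z : Plane × Plane => ‖H1.toL2 v z.1 - H1.toL2 v z.2‖ₑ ^ 2) := by
    have := (Lp.stronglyMeasurable (H1.toL2 v)).measurable
    fun_prop
  -- Both integrals are suprema over `n`; a pair of indices is dominated by its maximum.
  simp only [setLIntegral_iUnion_of_directed _ hmono.directed_le]
  rw [lintegral_iSup]
  · refine iSup_le fun n => ?_
    refine le_trans ?_ (step (max m n))
    refine (lintegral_mono_set (hmono (le_max_left m n))).trans ?_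
    exact lintegral_mono fun x => lintegral_mono_set (hmono (le_max_right m n))
  · intro n
    exact hvm.lintegral_prod_right'
  · intro i j hij x
    exact lintegral_mono_set (hmono hij)

/-! ### Charts adapted to a smooth domain -/

/-- A chart at `p` for `Ω`: the image under `graphChart e h` of a rectangle `(a, b) × (0, d)` lies
in `Ω` and exhausts `Ω` near `p`, while near `p` the boundary of `Ω` lies in the image of the bottom
edge `(a, b) × {0}`. -/
def HasAdaptedChart (Ω : Set Plane) (p : Plane) : Prop :=
  ∃ (e : Plane ≃ₗᵢ[ℝ] Plane) (h : ℝ → ℝ) (hh : ContDiff ℝ ∞ h) (a b d : ℝ) (V : Set Plane),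
    a < b ∧ 0 < d ∧ IsOpen V ∧ p ∈ V ∧
    graphChart e hh.continuous '' (Ioo a b ×ˢ Ioo 0 d) ⊆ Ω ∧
    V ∩ Ω ⊆ graphChart e hh.continuous '' (Ioo a b ×ˢ Ioo 0 d) ∧
    V ∩ frontier Ω ⊆ graphChart e hh.continuous '' (Ioo a b ×ˢ {0})

/-- Around an interior point, the chart is a rectangle above a horizontal line that passes below the
point, and `V` does not meet the boundary. -/
theorem exists_adapted_chart_of_mem (hΩ : IsOpen Ω) {p : Plane} (hp : p ∈ Ω) :
    HasAdaptedChart Ω p := by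
  obtain ⟨r, hr, hball⟩ := Metric.isOpen_iff.1 hΩ p hp
  have hh : ContDiff ℝ ∞ (fun _ : ℝ => p 1 - r / 2) := contDiff_const
  set Φ := graphChart (LinearIsometryEquiv.refl ℝ Plane) hh.continuous with hΦ
  have hsub : Φ '' (Ioo (p 0 - r / 2) (p 0 + r / 2) ×ˢ Ioo 0 r) ⊆ Ω := by
    rintro _ ⟨⟨s, t⟩, ⟨hs, ht⟩, rfl⟩
    apply hball
    have e1 : Φ (s, t) - p = (LinearIsometryEquiv.refl ℝ Plane).symm
        (WithLp.toLp 2 ![s - p 0, t - r / 2]) := by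
      ext i
      fin_cases i
      · rfl
      · change (p 1 - r / 2 + t) - p 1 = t - r / 2
        ring
    rw [Metric.mem_ball, dist_eq_norm, e1]
    refine (norm_toLp_pair_le _ _).trans_lt ?_
    have h1 : |s - p 0| < r / 2 := abs_lt.2 ⟨by linarith [hs.1], by linarith [hs.2]⟩
    have h2 : |t - r / 2| < r / 2 := abs_lt.2 ⟨by linarith [ht.1], by linarith [ht.2]⟩
    linarith
  refine ⟨_, _, hh, p 0 - r / 2, p 0 + r / 2, r,
    Φ '' (Ioo (p 0 - r / 2) (p 0 + r / 2) ×ˢ Ioo 0 r), by linarith, hr,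
    Φ.isOpenMap _ (isOpen_Ioo.prod isOpen_Ioo), ?_, hsub, inter_subset_left, ?_⟩
  · refine ⟨(p 0, r / 2), ⟨⟨by linarith, by linarith⟩, by linarith, by linarith⟩, ?_⟩
    ext i
    fin_cases i
    · rfl
    · change p 1 - r / 2 + r / 2 = p 1
      ring
  · rintro x ⟨hx, hxf⟩
    exact absurd (hsub hx) (by rw [hΩ.frontier_eq] at hxf; exact hxf.2)

theorem exists_adapted_chart_of_mem_frontier (hΩ : IsOpen Ω) (hs : HasSmoothBoundary Ω)
    {p : Plane} (hp : p ∈ frontier Ω) :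
    HasAdaptedChart Ω p := by
  obtain ⟨e, h, r, hr, hh, hball⟩ := hs p hp
  set Φ := graphChart e hh.continuous with hΦ
  have hin : ∀ x ∈ Metric.ball p r, (x ∈ Ω ↔ 0 < (Φ.symm x).2) := by
    intro x hx
    rw [hball x hx, hΦ, graphChart_symm_apply, sub_pos]
  -- A boundary point is not above the graph, as `Ω` is open, nor below it, where a neighbourhood
  -- would be disjoint from `Ω`.
  have hzero : ∀ x ∈ Metric.ball p r, x ∈ frontier Ω → (Φ.symm x).2 = 0 := by
    intro x hx hxf
    rw [hΩ.frontier_eq] at hxf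
    refine le_antisymm (not_lt.1 fun hlt => hxf.2 ((hin x hx).2 hlt)) (not_lt.1 fun hlt => ?_)
    have hopen : IsOpen (Metric.ball p r ∩ {y | (Φ.symm y).2 < 0}) :=
      Metric.isOpen_ball.inter (isOpen_lt (continuous_snd.comp Φ.symm.continuous) continuous_const)
    obtain ⟨y, ⟨hy1, hy2⟩, hyΩ⟩ := mem_closure_iff.1 hxf.1 _ hopen ⟨hx, hlt⟩
    exact absurd ((hin y hy1).1 hyΩ) (not_lt.2 (le_of_lt hy2))
  set s₀ := (Φ.symm p).1 with hs₀
  have hp0 : Φ.symm p = (s₀, 0) := Prod.ext rfl (hzero p (Metric.mem_ball_self hr) hp)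
  have hopen : IsOpen (Φ ⁻¹' Metric.ball p r) := Metric.isOpen_ball.preimage Φ.continuous
  obtain ⟨δ, hδ, hbox⟩ := Metric.isOpen_iff.1 hopen (s₀, 0) (by
    rw [← hp0]; simp [hr])
  rw [← ball_prod_same, Real.ball_eq_Ioo, Real.ball_eq_Ioo, zero_sub, zero_add] at hbox
  refine ⟨e, h, hh, s₀ - δ, s₀ + δ, δ, Φ '' (Ioo (s₀ - δ) (s₀ + δ) ×ˢ Ioo (-δ) δ), by linarith, hδ,
    Φ.isOpenMap _ (isOpen_Ioo.prod isOpen_Ioo), ?_, ?_, ?_, ?_⟩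
  · refine ⟨(s₀, 0), ⟨⟨by linarith, by linarith⟩, by linarith, hδ⟩, ?_⟩
    rw [← hp0, Homeomorph.apply_symm_apply]
  · rintro _ ⟨⟨s, t⟩, ⟨hs, ht⟩, rfl⟩
    have hb : Φ (s, t) ∈ Metric.ball p r := hbox ⟨hs, by linarith [ht.1], ht.2⟩
    rw [hin _ hb, Homeomorph.symm_apply_apply]
    exact ht.1
  · rintro _ ⟨⟨⟨s, t⟩, ⟨hs, ht⟩, rfl⟩, hx⟩
    rw [hin _ (hbox ⟨hs, ht⟩), Homeomorph.symm_apply_apply] at hx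
    exact ⟨(s, t), ⟨hs, hx, ht.2⟩, rfl⟩
  · rintro _ ⟨⟨⟨s, t⟩, ⟨hs, ht⟩, rfl⟩, hx⟩
    have h0 := hzero _ (hbox ⟨hs, ht⟩) hx
    rw [Homeomorph.symm_apply_apply] at h0
    exact ⟨(s, t), ⟨hs, h0⟩, rfl⟩

theorem exists_adapted_chart (hΩ : IsSmoothBoundedDomain Ω) {p : Plane} (hp : p ∈ closure Ω) :
    HasAdaptedChart Ω p := by
  by_cases hpΩ : p ∈ Ω
  · exact exists_adapted_chart_of_mem hΩ.isOpen hpΩ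
  · exact exists_adapted_chart_of_mem_frontier hΩ.isOpen hΩ.smoothBoundary
      (by rw [hΩ.isOpen.frontier_eq]; exact ⟨hp, hpΩ⟩)

theorem IsSmoothBoundedDomain.volume_ne_top (hΩ : IsSmoothBoundedDomain Ω) : volume Ω ≠ ⊤ :=
  hΩ.isBounded.measure_lt_top.ne

theorem IsSmoothBoundedDomain.isCompact_closure (hΩ : IsSmoothBoundedDomain Ω) :
    IsCompact (closure Ω) :=
  hΩ.isBounded.isCompact_closure

/-! ### The Poincaré-Wirtinger inequality -/

/-- The Poincaré-Wirtinger inequality on a part `U` of `Ω`, with the gradient integrated over all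
of `Ω` and an unspecified constant `c` in the place of the mean value. -/
def PoincareWirtinger (Ω U : Set Plane) : Prop :=
  ∃ C : ENNReal, C ≠ ⊤ ∧ ∀ v : H1 Ω, ∃ c : ℝ,
    ∫⁻ x in U, ‖H1.toL2 v x - c‖ₑ ^ 2 ≤ C * ∫⁻ x in Ω, ‖H1.grad v x‖ₑ ^ 2

theorem PoincareWirtinger.mono {U V : Set Plane} (hV : PoincareWirtinger Ω V) (h : U ⊆ V) :
    PoincareWirtinger Ω U := by
  obtain ⟨C, hC, H⟩ := hV
  refine ⟨C, hC, fun v => ?_⟩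
  obtain ⟨c, hc⟩ := H v
  exact ⟨c, (lintegral_mono_set h).trans hc⟩

theorem poincareWirtinger_graphChart (hΩ : IsOpen Ω) (hfin : volume Ω ≠ ⊤)
    {e : Plane ≃ₗᵢ[ℝ] Plane} {h : ℝ → ℝ} (hh : ContDiff ℝ ∞ h) {a b d : ℝ} (hab : a < b)
    (hd : 0 < d) (hsub : graphChart e hh.continuous '' (Ioo a b ×ˢ Ioo 0 d) ⊆ Ω) :
    PoincareWirtinger Ω (graphChart e hh.continuous '' (Ioo a b ×ˢ Ioo 0 d)) := by
  obtain ⟨M, hM0, hM⟩ := exists_deriv_bound hh a b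
  set U := graphChart e hh.continuous '' (Ioo a b ×ˢ Ioo 0 d) with hU
  have hUo : IsOpen U := (graphChart e hh.continuous).isOpenMap _ (isOpen_Ioo.prod isOpen_Ioo)
  have hUne : U.Nonempty := ((nonempty_Ioo.2 hab).prod (nonempty_Ioo.2 hd)).image _
  have hU0 : volume U ≠ 0 := (hUo.measure_pos volume hUne).ne'
  have hUt : volume U ≠ ⊤ := ne_top_of_le_ne_top hfin (measure_mono hsub)
  set l := max (b - a) d
  refine ⟨(4 * ENNReal.ofReal l ^ 4 * ENNReal.ofReal (1 + M) ^ 2) / volume U,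
    ENNReal.div_ne_top (by finiteness) hU0, fun v => ?_⟩
  have hvm : Measurable (fun z : Plane × Plane => ‖H1.toL2 v z.1 - H1.toL2 v z.2‖ₑ ^ 2) := by
    have := (Lp.stronglyMeasurable (H1.toL2 v)).measurable
    fun_prop
  -- Some value of `v` serves as the constant: the inner integral is at most its average there.
  obtain ⟨y, -, hy⟩ := exists_le_setLAverage (μ := volume) (s := U)
    (f := fun y => ∫⁻ x in U, ‖H1.toL2 v y - H1.toL2 v x‖ₑ ^ 2) hU0 hUt
    hvm.lintegral_prod_right'.aemeasurable
  refine ⟨H1.toL2 v y, ?_⟩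
  simp only [enorm_sub_rev _ (H1.toL2 v y)]
  refine hy.trans ?_
  rw [setLAverage_eq, ENNReal.mul_div_right_comm.symm]
  gcongr
  exact lintegral_lintegral_enorm_toL2_sub_sq_le_graphChart hΩ hh (le_max_left _ _)
    (le_max_right _ _) hM0 hM hsub v

/-- On the overlap the two constants differ by no more than a multiple of the gradient norm. -/
theorem PoincareWirtinger.union {U V : Set Plane} (hU : PoincareWirtinger Ω U)
    (hV : PoincareWirtinger Ω V) (h0 : volume (U ∩ V) ≠ 0) (hVt : volume V ≠ ⊤) :
    PoincareWirtinger Ω (U ∪ V) := by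
  obtain ⟨C, hC, H⟩ := hU
  obtain ⟨D, hD, H'⟩ := hV
  have ht : volume (U ∩ V) ≠ ⊤ := ne_top_of_le_ne_top hVt (measure_mono inter_subset_right)
  refine ⟨C + (2 * D + 2 * ((2 * C + 2 * D) / volume (U ∩ V)) * volume V), ?_, fun v => ?_⟩
  · have := ENNReal.div_ne_top (x := 2 * C + 2 * D) (by finiteness) h0
    finiteness
  obtain ⟨c, hc⟩ := H v
  obtain ⟨c', hc'⟩ := H' v
  refine ⟨c, ?_⟩
  set G := ∫⁻ x in Ω, ‖H1.grad v x‖ₑ ^ 2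
  have hm : ∀ k : ℝ, Measurable fun x => ‖H1.toL2 v x - k‖ₑ ^ 2 := by
    intro k
    have := (Lp.stronglyMeasurable (H1.toL2 v)).measurable
    fun_prop
  have hcc : ‖c' - c‖ₑ ^ 2 ≤ (2 * C + 2 * D) / volume (U ∩ V) * G := by
    rw [← ENNReal.mul_div_right_comm, ENNReal.le_div_iff_mul_le (Or.inl h0) (Or.inl ht)]
    calc ‖c' - c‖ₑ ^ 2 * volume (U ∩ V) = ∫⁻ x in U ∩ V, ‖c' - c‖ₑ ^ 2 := by simp
      _ ≤ ∫⁻ x in U ∩ V, (2 * ‖H1.toL2 v x - c‖ₑ ^ 2 + 2 * ‖H1.toL2 v x - c'‖ₑ ^ 2) := by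
          refine lintegral_mono fun x => ?_
          have e : c' - c = (H1.toL2 v x - c) + (c' - H1.toL2 v x) := by ring
          rw [e, enorm_sub_rev (H1.toL2 v x) c']
          exact enorm_add_sq_le _ _
      _ = 2 * (∫⁻ x in U ∩ V, ‖H1.toL2 v x - c‖ₑ ^ 2) +
            2 * ∫⁻ x in U ∩ V, ‖H1.toL2 v x - c'‖ₑ ^ 2 := by
          rw [lintegral_add_left ((hm c).const_mul _), lintegral_const_mul _ (hm c),
            lintegral_const_mul _ (hm c')]
      _ ≤ 2 * (C * G) + 2 * (D * G) := by
          gcongr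
          · exact (lintegral_mono_set inter_subset_left).trans hc
          · exact (lintegral_mono_set inter_subset_right).trans hc'
      _ = (2 * C + 2 * D) * G := by ring
  have hVc : ∫⁻ x in V, ‖H1.toL2 v x - c‖ₑ ^ 2 ≤
      2 * (D * G) + 2 * ((2 * C + 2 * D) / volume (U ∩ V) * G) * volume V := by
    calc ∫⁻ x in V, ‖H1.toL2 v x - c‖ₑ ^ 2
        ≤ ∫⁻ x in V, (2 * ‖H1.toL2 v x - c'‖ₑ ^ 2 + 2 * ‖c' - c‖ₑ ^ 2) := by
          refine lintegral_mono fun x => ?_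
          have e : H1.toL2 v x - c = (H1.toL2 v x - c') + (c' - c) := by ring
          rw [e]
          exact enorm_add_sq_le _ _
      _ = 2 * (∫⁻ x in V, ‖H1.toL2 v x - c'‖ₑ ^ 2) + 2 * ‖c' - c‖ₑ ^ 2 * volume V := by
          rw [lintegral_add_left ((hm c').const_mul _), lintegral_const_mul _ (hm c')]
          simp
      _ ≤ _ := by gcongr
  calc ∫⁻ x in U ∪ V, ‖H1.toL2 v x - c‖ₑ ^ 2
      ≤ (∫⁻ x in U, ‖H1.toL2 v x - c‖ₑ ^ 2) + ∫⁻ x in V, ‖H1.toL2 v x - c‖ₑ ^ 2 :=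
        lintegral_union_le _ _ _
    _ ≤ C * G + (2 * (D * G) + 2 * ((2 * C + 2 * D) / volume (U ∩ V) * G) * volume V) :=
        add_le_add hc hVc
    _ = _ := by ring

/-- A maximal union of members of the cover on which the inequality holds is all of `Ω`, because
`Ω` is connected. -/
theorem PoincareWirtinger.of_finite_cover (hconn : IsConnected Ω) (hfin : volume Ω ≠ ⊤)
    {ι : Type*} (s : Finset ι) (U : ι → Set Plane) (hUo : ∀ i ∈ s, IsOpen (U i))
    (hUΩ : ∀ i ∈ s, U i ⊆ Ω) (hcover : Ω ⊆ ⋃ i ∈ s, U i)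
    (hP : ∀ i ∈ s, PoincareWirtinger Ω (U i)) : PoincareWirtinger Ω Ω := by
  classical
  obtain ⟨x, hx⟩ := hconn.nonempty
  obtain ⟨i₀, hi₀, hxi⟩ := mem_iUnion₂.1 (hcover hx)
  let F := s.powerset.filter fun J => i₀ ∈ J ∧ PoincareWirtinger Ω (⋃ i ∈ J, U i)
  have hF : F.Nonempty := ⟨{i₀}, by simp [F, hi₀, hP i₀ hi₀]⟩
  obtain ⟨J, hJF, hmax⟩ := F.exists_max_image Finset.card hF
  obtain ⟨hJs, hi₀J, hJP⟩ : J ⊆ s ∧ i₀ ∈ J ∧ PoincareWirtinger Ω (⋃ i ∈ J, U i) := by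
    simpa [F] using hJF
  set A := ⋃ i ∈ J, U i with hA
  set B := ⋃ i ∈ s \ J, U i with hB
  have hAo : IsOpen A := isOpen_biUnion fun i hi => hUo i (hJs hi)
  have hBo : IsOpen B := isOpen_biUnion fun i hi => hUo i (Finset.sdiff_subset hi)
  have hAB : Ω ⊆ A ∪ B := by
    intro y hy
    obtain ⟨i, hi, hyi⟩ := mem_iUnion₂.1 (hcover hy)
    by_cases hiJ : i ∈ J
    · exact Or.inl (mem_iUnion₂.2 ⟨i, hiJ, hyi⟩)
    · exact Or.inr (mem_iUnion₂.2 ⟨i, Finset.mem_sdiff.2 ⟨hi, hiJ⟩, hyi⟩)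
  by_cases hne : (Ω ∩ B).Nonempty
  · obtain ⟨y, -, hyA, hyB⟩ := hconn.isPreconnected A B hAo hBo hAB
      ⟨x, hx, mem_iUnion₂.2 ⟨i₀, hi₀J, hxi⟩⟩ hne
    obtain ⟨j, hj, hyj⟩ := mem_iUnion₂.1 hyB
    obtain ⟨hjs, hjJ⟩ := Finset.mem_sdiff.1 hj
    have h0 : volume (A ∩ U j) ≠ 0 :=
      ((hAo.inter (hUo j hjs)).measure_pos volume ⟨y, hyA, hyj⟩).ne'
    have hPj : PoincareWirtinger Ω (⋃ i ∈ insert j J, U i) := by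
      have := hJP.union (hP j hjs) h0 (ne_top_of_le_ne_top hfin (measure_mono (hUΩ j hjs)))
      rwa [Finset.set_biUnion_insert, union_comm]
    have hmem : insert j J ∈ F := by
      simp only [F, Finset.mem_filter, Finset.mem_powerset]
      exact ⟨Finset.insert_subset hjs hJs, Finset.mem_insert_of_mem hi₀J, hPj⟩
    have := hmax _ hmem
    rw [Finset.card_insert_of_notMem hjJ] at this
    omega
  · refine hJP.mono fun y hy => (hAB hy).resolve_right fun hyB => hne ⟨y, hy, hyB⟩

theorem poincareWirtinger_self (hΩ : IsSmoothBoundedDomain Ω) : PoincareWirtinger Ω Ω := by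
  choose e h hh a b d V hab hd hVo hpV hsub hVΩ hVf using
    fun p : closure Ω => exists_adapted_chart hΩ p.2
  obtain ⟨t, ht⟩ := hΩ.isCompact_closure.elim_finite_subcover V hVo
    fun p hp => mem_iUnion.2 ⟨⟨p, hp⟩, hpV ⟨p, hp⟩⟩
  refine PoincareWirtinger.of_finite_cover hΩ.isConnected hΩ.volume_ne_top t
    (fun p => V p ∩ Ω) (fun p _ => (hVo p).inter hΩ.isOpen) (fun p _ => inter_subset_right) ?_ ?_
  · intro x hx
    obtain ⟨p, hp, hxp⟩ := mem_iUnion₂.1 (ht (subset_closure hx))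
    exact mem_iUnion₂.2 ⟨p, hp, hxp, hx⟩
  · intro p _
    exact (poincareWirtinger_graphChart hΩ.isOpen hΩ.volume_ne_top (hh p) (hab p) (hd p)
      (hsub p)).mono (hVΩ p)

/-! ### The trace inequality for smooth functions -/

/-- Arc length on the graph of `h` over `(a, b)` is at most a multiple of the length of the
parameter `s`, because the parametrization is Lipschitz. -/
theorem exists_lintegral_hausdorff_edge_le {e : Plane ≃ₗᵢ[ℝ] Plane} {h : ℝ → ℝ}
    (hh : ContDiff ℝ ∞ h) (a b : ℝ) :
    ∃ K : ENNReal, K ≠ ⊤ ∧ ∀ f : Plane → ENNReal, Measurable f →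
      ∫⁻ x in graphChart e hh.continuous '' (Ioo a b ×ˢ {0}), f x ∂μH[1] ≤
        K * ∫⁻ s in Ioo a b, f (graphChart e hh.continuous (s, 0)) := by
  obtain ⟨M, hM0, hM⟩ := exists_deriv_bound hh a b
  set Φ := graphChart e hh.continuous with hΦ
  set γ : ℝ → Plane := fun s => Φ (s, 0) with hγ
  have hγc : Continuous γ := Φ.continuous.comp (by fun_prop)
  have hlip : LipschitzOnWith (1 + M).toNNReal γ (Ioo a b) := by
    refine (convex_Ioo a b).lipschitzOnWith_of_nnnorm_hasDerivWithin_le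
      (f' := graphTangent e h) (fun s _ => ?_) (fun s hs => ?_)
    · exact (hasDerivAt_graphChart_fst hh.continuous (hh.differentiable (by simp)) s 0).hasDerivWithinAt
    · rw [← NNReal.coe_le_coe, coe_nnnorm, Real.coe_toNNReal _ (by positivity)]
      refine (norm_toLp_pair_le _ _).trans ?_
      simpa using hM s (Ioo_subset_Icc_self hs)
  have hE : Φ '' (Ioo a b ×ˢ {0}) = γ '' Ioo a b := by
    rw [prod_singleton, image_image]
  refine ⟨(1 + M).toNNReal, ENNReal.coe_ne_top, fun f hf => ?_⟩
  have hle : (μH[1] : Measure Plane).restrict (Φ '' (Ioo a b ×ˢ {0})) ≤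
      ((1 + M).toNNReal : ENNReal) • (volume.restrict (Ioo a b)).map γ := by
    refine Measure.le_iff.2 fun S hS => ?_
    rw [restrict_apply hS, hE, Measure.smul_apply, smul_eq_mul,
      Measure.map_apply hγc.measurable hS, restrict_apply (hγc.measurable hS)]
    have e1 : S ∩ γ '' Ioo a b = γ '' (γ ⁻¹' S ∩ Ioo a b) := (image_preimage_inter _ _ _).symm
    rw [e1]
    refine ((hlip.mono inter_subset_right).hausdorffMeasure_image_le zero_le_one).trans ?_
    rw [hausdorffMeasure_real, ENNReal.rpow_one]
  refine (lintegral_mono' hle le_rfl).trans ?_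
  rw [lintegral_smul_measure, lintegral_map hf hγc.measurable, smul_eq_mul]

/-- The trace inequality for the piece of the boundary covered by one chart. -/
theorem exists_lintegral_enorm_sq_edge_le {e : Plane ≃ₗᵢ[ℝ] Plane} {h : ℝ → ℝ}
    (hh : ContDiff ℝ ∞ h) (a b : ℝ) {d : ℝ} (hd : 0 < d)
    (hsub : graphChart e hh.continuous '' (Ioo a b ×ˢ Ioo 0 d) ⊆ Ω) :
    ∃ C : ENNReal, C ≠ ⊤ ∧ ∀ φ : Plane → ℝ, ContDiff ℝ ∞ φ →
      ∫⁻ x in graphChart e hh.continuous '' (Ioo a b ×ˢ {0}), ‖φ x‖ₑ ^ 2 ∂μH[1] ≤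
        C * ((∫⁻ x in Ω, ‖φ x‖ₑ ^ 2) + ∫⁻ x in Ω, ‖fderiv ℝ φ x‖ₑ ^ 2) := by
  obtain ⟨K, hK, HK⟩ := exists_lintegral_hausdorff_edge_le (e := e) hh a b
  have hd0 : ENNReal.ofReal d ≠ 0 := by simpa using hd
  set L := ENNReal.ofReal d with hL
  refine ⟨K * ((2 + 2 * L ^ 2) / L), ?_, fun φ hφ => ?_⟩
  · have := ENNReal.div_ne_top (x := 2 + 2 * L ^ 2) (by finiteness) hd0
    finiteness
  set Φ := graphChart e hh.continuous with hΦ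
  have hφc : Continuous φ := hφ.continuous
  have hdφ : Continuous (fderiv ℝ φ) := hφ.continuous_fderiv (by simp)
  refine (HK (fun x => ‖φ x‖ₑ ^ 2) (by fun_prop)).trans ?_
  rw [mul_assoc]
  refine mul_le_mul_right ?_ K
  rw [← ENNReal.mul_div_right_comm, ENNReal.le_div_iff_mul_le (Or.inl hd0)
    (Or.inl ENNReal.ofReal_ne_top), mul_comm]
  have hΦc : Continuous Φ := Φ.continuous
  have h1 := lintegral_enorm_sq_edge_le_rectangle (f := fun z => φ (Φ z))
    (D₂ := fun z => fderiv ℝ φ (Φ z) (e.symm (WithLp.toLp 2 ![0, 1]))) (hφc.comp hΦc)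
    (fun s t => ((hφ.differentiable (by simp)) _).hasFDerivAt.comp_hasDerivAt t
      (hasDerivAt_graphChart_snd hh.continuous s t))
    ((hdφ.comp hΦc).clm_apply continuous_const) (a := a) (b := b) hd
  refine h1.trans ?_
  have hb : ∀ z, ‖fderiv ℝ φ (Φ z) (e.symm (WithLp.toLp 2 ![0, 1]))‖ₑ ^ 2 ≤
      ‖fderiv ℝ φ (Φ z)‖ₑ ^ 2 := by
    intro z
    gcongr
    rw [← ofReal_norm, ← ofReal_norm]
    apply ENNReal.ofReal_le_ofReal
    refine (ContinuousLinearMap.le_opNorm _ _).trans ?_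
    have h2 : ‖e.symm (WithLp.toLp 2 ![0, 1])‖ ≤ 1 := (norm_toLp_pair_le _ _).trans (by simp)
    exact mul_le_of_le_one_right (norm_nonneg _) h2
  have i1 : ∫⁻ z in Ioo a b ×ˢ Ioo 0 d, ‖φ (Φ z)‖ₑ ^ 2 ≤ ∫⁻ x in Ω, ‖φ x‖ₑ ^ 2 := by
    rw [← setLIntegral_graphChart hh.continuous (fun x => ‖φ x‖ₑ ^ 2)]
    exact lintegral_mono_set hsub
  have i2 : ∫⁻ z in Ioo a b ×ˢ Ioo 0 d,
      ‖fderiv ℝ φ (Φ z) (e.symm (WithLp.toLp 2 ![0, 1]))‖ₑ ^ 2 ≤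
      ∫⁻ x in Ω, ‖fderiv ℝ φ x‖ₑ ^ 2 := by
    refine (lintegral_mono hb).trans ?_
    rw [← setLIntegral_graphChart hh.continuous (fun x => ‖fderiv ℝ φ x‖ₑ ^ 2)]
    exact lintegral_mono_set hsub
  calc _ ≤ 2 * (∫⁻ x in Ω, ‖φ x‖ₑ ^ 2) + 2 * L ^ 2 * ∫⁻ x in Ω, ‖fderiv ℝ φ x‖ₑ ^ 2 := by gcongr
    _ ≤ (2 + 2 * L ^ 2) * (∫⁻ x in Ω, ‖φ x‖ₑ ^ 2) +
        (2 + 2 * L ^ 2) * ∫⁻ x in Ω, ‖fderiv ℝ φ x‖ₑ ^ 2 := by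
        gcongr
        · exact le_self_add
        · exact le_add_self
    _ = _ := by ring

theorem lintegral_biUnion_finset_le {α ι : Type*} [MeasurableSpace α] (μ : Measure α)
    (f : α → ENNReal) (t : Finset ι) (E : ι → Set α) :
    ∫⁻ x in ⋃ i ∈ t, E i, f x ∂μ ≤ ∑ i ∈ t, ∫⁻ x in E i, f x ∂μ := by
  classical
  induction t using Finset.induction_on with
  | empty => simp
  | insert i t hi ih =>
    rw [Finset.set_biUnion_insert, Finset.sum_insert hi]
    exact (lintegral_union_le _ _ _).trans (by gcongr)

theorem exists_boundary_cover (hΩ : IsSmoothBoundedDomain Ω) :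
    ∃ (t : Finset (closure Ω)) (E : closure Ω → Set Plane), frontier Ω ⊆ ⋃ p ∈ t, E p ∧
      (∀ p, μH[1] (E p) ≠ ⊤) ∧
      ∀ p, ∃ C : ENNReal, C ≠ ⊤ ∧ ∀ φ : Plane → ℝ, ContDiff ℝ ∞ φ →
        ∫⁻ x in E p, ‖φ x‖ₑ ^ 2 ∂μH[1] ≤
          C * ((∫⁻ x in Ω, ‖φ x‖ₑ ^ 2) + ∫⁻ x in Ω, ‖fderiv ℝ φ x‖ₑ ^ 2) := by
  choose e h hh a b d V hab hd hVo hpV hsub hVΩ hVf using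
    fun p : closure Ω => exists_adapted_chart hΩ p.2
  obtain ⟨t, ht⟩ := hΩ.isCompact_closure.elim_finite_subcover V hVo
    fun p hp => mem_iUnion.2 ⟨⟨p, hp⟩, hpV ⟨p, hp⟩⟩
  refine ⟨t, fun p => graphChart (e p) (hh p).continuous '' (Ioo (a p) (b p) ×ˢ {0}), ?_, ?_, ?_⟩
  · intro x hx
    obtain ⟨p, hp, hxp⟩ := mem_iUnion₂.1 (ht (frontier_subset_closure hx))
    exact mem_iUnion₂.2 ⟨p, hp, hVf p ⟨hxp, hx⟩⟩
  · intro p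
    obtain ⟨K, hK, HK⟩ := exists_lintegral_hausdorff_edge_le (e := e p) (hh p) (a p) (b p)
    have := HK (fun _ => 1) measurable_const
    simp only [lintegral_const, restrict_apply_univ, one_mul, Real.volume_Ioo] at this
    exact ne_top_of_le_ne_top (by finiteness) this
  · intro p
    exact exists_lintegral_enorm_sq_edge_le (hh p) (a p) (b p) (hd p) (hsub p)

theorem IsSmoothBoundedDomain.hausdorffMeasure_frontier_ne_top (hΩ : IsSmoothBoundedDomain Ω) :
    μH[1] (frontier Ω) ≠ ⊤ := by
  obtain ⟨t, E, hcover, hfin, -⟩ := exists_boundary_cover hΩ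
  refine ne_top_of_le_ne_top ?_ ((measure_mono hcover).trans (measure_biUnion_finset_le t E))
  exact ENNReal.sum_ne_top.2 fun p _ => hfin p

/-- The trace inequality for smooth functions. -/
theorem exists_trace_inequality (hΩ : IsSmoothBoundedDomain Ω) :
    ∃ C : ENNReal, C ≠ ⊤ ∧ ∀ φ : Plane → ℝ, ContDiff ℝ ∞ φ →
      ∫⁻ x in frontier Ω, ‖φ x‖ₑ ^ 2 ∂μH[1] ≤
        C * ((∫⁻ x in Ω, ‖φ x‖ₑ ^ 2) + ∫⁻ x in Ω, ‖fderiv ℝ φ x‖ₑ ^ 2) := by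
  obtain ⟨t, E, hcover, -, hC⟩ := exists_boundary_cover hΩ
  choose C hCt hC using hC
  refine ⟨∑ p ∈ t, C p, ENNReal.sum_ne_top.2 fun p _ => hCt p, fun φ hφ => ?_⟩
  refine (lintegral_mono_set hcover).trans ((lintegral_biUnion_finset_le _ _ _ _).trans ?_)
  rw [Finset.sum_mul]
  exact Finset.sum_le_sum fun p _ => hC p φ hφ

/-! ### The space `H¹(Ω)` and the trace operator -/

theorem memLp_two_of_continuous {F : Type*} [NormedAddCommGroup F] {μ : Measure Plane}
    {s : Set Plane} (hs : MeasurableSet s) (hc : IsCompact (closure s)) (hfin : μ s ≠ ⊤)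
    {f : Plane → F} (hf : Continuous f) : MemLp f 2 (μ.restrict s) := by
  obtain ⟨C, hC⟩ := hc.exists_bound_of_continuousOn hf.continuousOn
  have : IsFiniteMeasure (μ.restrict s) := ⟨by simpa [lt_top_iff_ne_top] using hfin⟩
  refine MemLp.of_bound hf.aestronglyMeasurable C ?_
  filter_upwards [ae_restrict_mem hs] with x hx
  exact hC x (subset_closure hx)

theorem lintegral_enorm_sq_eq {α F : Type*} [MeasurableSpace α] [NormedAddCommGroup F]
    {μ : Measure α} (u : Lp F 2 μ) : ∫⁻ x, ‖u x‖ₑ ^ 2 ∂μ = ‖u‖ₑ ^ 2 := by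
  rw [Lp.enorm_def, eLpNorm_eq_lintegral_rpow_enorm_toReal (by norm_num) (by norm_num),
    ← ENNReal.rpow_natCast, ← ENNReal.rpow_mul]
  norm_num

theorem H1.enorm_sq (v : H1 Ω) : ‖v‖ₑ ^ 2 = ‖H1.toL2 v‖ₑ ^ 2 + ‖H1.grad v‖ₑ ^ 2 := by
  have h : ‖v‖ ^ 2 = ‖H1.toL2 v‖ ^ 2 + ‖H1.grad v‖ ^ 2 := WithLp.prod_norm_sq_eq_of_L2 v.1
  simp only [← ofReal_norm, ← ENNReal.ofReal_pow (norm_nonneg _)]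
  rw [h, ENNReal.ofReal_add (by positivity) (by positivity)]

theorem norm_le_of_enorm_sq_le {E F : Type*} [SeminormedAddCommGroup E] [SeminormedAddCommGroup F]
    {x : E} {y : F} {C : ENNReal} (hC : C ≠ ⊤) (h : ‖x‖ₑ ^ 2 ≤ C * ‖y‖ₑ ^ 2) :
    ‖x‖ ≤ √C.toReal * ‖y‖ := by
  have h2 : ‖x‖ ^ 2 ≤ C.toReal * ‖y‖ ^ 2 := by
    have := ENNReal.toReal_mono (by finiteness) h
    simpa using this
  rw [← Real.sqrt_sq (norm_nonneg x), ← Real.sqrt_sq (norm_nonneg y),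
    ← Real.sqrt_mul ENNReal.toReal_nonneg]
  exact Real.sqrt_le_sqrt h2

theorem integral_mul_partialDeriv_eq {φ ψ : Plane → ℝ} (hφ : ContDiff ℝ ∞ φ)
    (hψ : ContDiff ℝ ∞ ψ) (hc : HasCompactSupport ψ) (hs : tsupport ψ ⊆ Ω) (i : Fin 2) :
    ∫ x in Ω, φ x * partialDeriv i ψ x = -∫ x in Ω, partialDeriv i φ x * ψ x := by
  have c1 : Continuous (partialDeriv i φ) :=
    (hφ.continuous_fderiv (by simp)).clm_apply continuous_const
  have c2 : Continuous (partialDeriv i ψ) :=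
    (hψ.continuous_fderiv (by simp)).clm_apply continuous_const
  have s2 : HasCompactSupport (partialDeriv i ψ) := hc.fderiv_apply ℝ _
  rw [setIntegral_eq_integral_of_forall_compl_eq_zero,
    setIntegral_eq_integral_of_forall_compl_eq_zero]
  · refine integral_mul_fderiv_eq_neg_fderiv_mul_of_integrable ?_ ?_ ?_ ?_ ?_
    · exact (c1.mul hψ.continuous).integrable_of_hasCompactSupport hc.mul_left
    · exact (hφ.continuous.mul c2).integrable_of_hasCompactSupport s2.mul_left
    · exact (hφ.continuous.mul hψ.continuous).integrable_of_hasCompactSupport hc.mul_left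
    · exact fun x _ => hφ.differentiable (by simp) x
    · exact fun x _ => hψ.differentiable (by simp) x
  · intro x hx
    rw [image_eq_zero_of_notMem_tsupport (fun h => hx (hs h)), mul_zero]
  · intro x hx
    have : fderiv ℝ ψ x = 0 :=
      image_eq_zero_of_notMem_tsupport fun h => hx (hs (tsupport_fderiv_subset ℝ h))
    rw [partialDeriv, this]
    simp

/-- The weak gradient is determined by the function. -/
theorem H1.ext_toL2 (hΩ : IsOpen Ω) {v w : H1 Ω} (h : H1.toL2 v = H1.toL2 w) : v = w := by
  have hcomp : ∀ i, ∀ᵐ x ∂volume.restrict Ω, H1.grad v x i - H1.grad w x i = 0 := by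
    intro i
    have hm : MemLp (fun x => H1.grad v x i - H1.grad w x i) 2 (volume.restrict Ω) :=
      (memLp_coord _ i).sub (memLp_coord _ i)
    have h1 := hΩ.ae_eq_zero_of_integral_contDiff_smul_eq_zero
      (μ := volume.restrict Ω) ((hm.locallyIntegrable (by norm_num)).locallyIntegrableOn Ω) ?_
    · filter_upwards [h1, ae_restrict_mem hΩ.measurableSet] with x hx hxΩ using hx hxΩ
    · intro φ hφ hc hs
      have e1 : ∫ x in Ω, H1.toL2 v x * partialDeriv i φ x = -∫ x in Ω, H1.grad v x i * φ x :=
        v.2 φ hφ hc hs i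
      have e2 : ∫ x in Ω, H1.toL2 w x * partialDeriv i φ x = -∫ x in Ω, H1.grad w x i * φ x :=
        w.2 φ hφ hc hs i
      rw [← h, e1, neg_inj] at e2
      have e3 := integral_sub ((memLp_coord (H1.grad v) i).integrable_mul (memLp_of_test hφ hc))
        ((memLp_coord (H1.grad w) i).integrable_mul (memLp_of_test hφ hc))
      simp only [Pi.mul_apply] at e3
      rw [e2, sub_self] at e3
      rw [← e3]
      congr 1; ext x
      rw [smul_eq_mul]; ring
  have hgrad : H1.grad v = H1.grad w := by
    apply Lp.ext
    filter_upwards [hcomp 0, hcomp 1] with x h0 h1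
    ext i
    fin_cases i
    · exact sub_eq_zero.1 h0
    · exact sub_eq_zero.1 h1
  apply Subtype.ext
  apply (WithLp.equiv 2 _).injective
  exact Prod.ext h hgrad

/-- The smooth functions on the plane. -/
def smoothFunctions : Submodule ℝ (Plane → ℝ) where
  carrier := {φ | ContDiff ℝ ∞ φ}
  zero_mem' := by
    change ContDiff ℝ ∞ (fun _ : Plane => (0 : ℝ))
    exact contDiff_const
  add_mem' := by
    intro φ ψ hφ hψ
    have h1 : ContDiff ℝ ∞ φ := hφ
    have h2 : ContDiff ℝ ∞ ψ := hψ
    exact h1.add h2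
  smul_mem' := by
    intro c φ hφ
    have h1 : ContDiff ℝ ∞ φ := hφ
    exact h1.const_smul c

theorem contDiff_of_smoothFunctions (φ : smoothFunctions) : ContDiff ℝ ∞ (φ : Plane → ℝ) := by
  exact φ.2

/-- The gradient, as a linear map on the smooth functions. -/
noncomputable def gradientMap : smoothFunctions →ₗ[ℝ] (Plane → Plane) where
  toFun φ := gradient (φ : Plane → ℝ)
  map_add' φ ψ := by
    ext x : 1
    have h1 : DifferentiableAt ℝ (φ : Plane → ℝ) x := (contDiff_of_smoothFunctions φ).differentiable (by simp) x
    have h2 : DifferentiableAt ℝ (ψ : Plane → ℝ) x := (contDiff_of_smoothFunctions ψ).differentiable (by simp) x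
    simp only [gradient, Submodule.coe_add, Pi.add_apply]
    rw [fderiv_add h1 h2, map_add]
  map_smul' c φ := by
    ext x : 1
    have h1 : DifferentiableAt ℝ (φ : Plane → ℝ) x := (contDiff_of_smoothFunctions φ).differentiable (by simp) x
    simp only [gradient, Submodule.coe_smul, Pi.smul_apply, RingHom.id_apply]
    rw [fderiv_const_smul h1, map_smul]

theorem continuous_gradientMap (φ : smoothFunctions) : Continuous (gradientMap φ) :=
  (InnerProductSpace.toDual ℝ Plane).symm.continuous.comp
    ((contDiff_of_smoothFunctions φ).continuous_fderiv (by simp))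

/-- The `L²` classes of a linear family `A` of square integrable functions. -/
noncomputable def toLpMap {S F : Type*} [AddCommGroup S] [Module ℝ S] [NormedAddCommGroup F]
    [NormedSpace ℝ F] {μ : Measure Plane} (A : S →ₗ[ℝ] (Plane → F)) (hA : ∀ φ, MemLp (A φ) 2 μ) :
    S →ₗ[ℝ] Lp F 2 μ where
  toFun φ := (hA φ).toLp (A φ)
  map_add' φ ψ := by
    simp only [map_add]
    exact MemLp.toLp_add _ _
  map_smul' c φ := by
    simp only [map_smul]
    exact MemLp.toLp_const_smul _ _

theorem toLpMap_coeFn {S F : Type*} [AddCommGroup S] [Module ℝ S] [NormedAddCommGroup F]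
    [NormedSpace ℝ F] {μ : Measure Plane} (A : S →ₗ[ℝ] (Plane → F)) (hA : ∀ φ, MemLp (A φ) 2 μ)
    (φ : S) : toLpMap A hA φ =ᵐ[μ] A φ :=
  MemLp.coeFn_toLp (hA φ)

/-- The linear map that restricts smooth functions to `Ω`, as elements of `H¹(Ω)`. -/
theorem exists_smooth_to_H1 (hΩ : IsSmoothBoundedDomain Ω) :
    ∃ J : smoothFunctions →ₗ[ℝ] H1 Ω, ∀ φ : smoothFunctions,
      H1.toL2 (J φ) =ᵐ[volume.restrict Ω] (φ : Plane → ℝ) ∧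
      H1.grad (J φ) =ᵐ[volume.restrict Ω] gradient (φ : Plane → ℝ) := by
  have hΩm := hΩ.isOpen.measurableSet
  let A := toLpMap (μ := volume.restrict Ω) smoothFunctions.subtype
    fun φ => memLp_two_of_continuous hΩm hΩ.isCompact_closure hΩ.volume_ne_top
      (contDiff_of_smoothFunctions φ).continuous
  let B := toLpMap (μ := volume.restrict Ω) gradientMap
    fun φ => memLp_two_of_continuous hΩm hΩ.isCompact_closure hΩ.volume_ne_top
      (continuous_gradientMap φ)
  have hA : ∀ φ : smoothFunctions, A φ =ᵐ[volume.restrict Ω] (φ : Plane → ℝ) :=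
    fun φ => toLpMap_coeFn _ _ φ
  have hB : ∀ φ : smoothFunctions, B φ =ᵐ[volume.restrict Ω] gradient (φ : Plane → ℝ) :=
    fun φ => toLpMap_coeFn _ _ φ
  let J₀ : smoothFunctions →ₗ[ℝ] WithLp 2 (L2 Ω × L2Vec Ω) :=
    (WithLp.linearEquiv 2 ℝ (L2 Ω × L2Vec Ω)).symm.toLinearMap ∘ₗ (A.prod B)
  have hJ : ∀ φ, J₀ φ ∈ H1 Ω := by
    intro φ ψ hψ hc hs i
    change ∫ x in Ω, A φ x * partialDeriv i ψ x = -∫ x in Ω, B φ x i * ψ x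
    have e1 : ∫ x in Ω, A φ x * partialDeriv i ψ x = ∫ x in Ω, φ.1 x * partialDeriv i ψ x := by
      refine integral_congr_ae ?_
      filter_upwards [hA φ] with x hx
      rw [hx]
    have e2 : ∫ x in Ω, B φ x i * ψ x = ∫ x in Ω, partialDeriv i φ.1 x * ψ x := by
      refine integral_congr_ae ?_
      filter_upwards [hB φ] with x hx
      rw [hx, gradient_apply_eq_partialDeriv]
    rw [e1, e2]
    exact integral_mul_partialDeriv_eq (contDiff_of_smoothFunctions φ) hψ hc hs i
  exact ⟨J₀.codRestrict (H1 Ω) hJ, fun φ => ⟨hA φ, hB φ⟩⟩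

theorem isClosed_H1 : IsClosed (H1 Ω : Set (WithLp 2 (L2 Ω × L2Vec Ω))) := by
  have hset : (H1 Ω : Set (WithLp 2 (L2 Ω × L2Vec Ω))) =
      ⋂ (φ : Plane → ℝ) (_ : ContDiff ℝ ∞ φ) (_ : HasCompactSupport φ) (_ : tsupport φ ⊆ Ω)
        (i : Fin 2), {w | ∫ x in Ω, w.fst x * partialDeriv i φ x = -∫ x in Ω, w.snd x i * φ x} := by
    ext w
    simp only [mem_iInter]
    rfl
  rw [hset]
  refine isClosed_iInter fun φ => isClosed_iInter fun hφ => isClosed_iInter fun hc =>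
    isClosed_iInter fun _ => isClosed_iInter fun i => ?_
  have h1 := memLp_partialDeriv (Ω := Ω) hφ hc i
  have h2 : MemLp (fun x => φ x • (EuclideanSpace.single i 1 : Plane)) 2 (volume.restrict Ω) :=
    (ContinuousLinearMap.toSpanSingleton ℝ (EuclideanSpace.single i 1 : Plane)).comp_memLp'
      (memLp_of_test hφ hc)
  have e1 : ∀ w : WithLp 2 (L2 Ω × L2Vec Ω),
      ∫ x in Ω, w.fst x * partialDeriv i φ x = ⟪h1.toLp _, w.fst⟫ := by
    intro w
    rw [L2.inner_def]
    refine integral_congr_ae ?_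
    filter_upwards [h1.coeFn_toLp] with x hx
    rw [hx]; simp
  have e2 : ∀ w : WithLp 2 (L2 Ω × L2Vec Ω),
      ∫ x in Ω, w.snd x i * φ x = ⟪h2.toLp _, w.snd⟫ := by
    intro w
    rw [L2.inner_def]
    refine integral_congr_ae ?_
    filter_upwards [h2.coeFn_toLp] with x hx
    rw [hx, real_inner_smul_left, EuclideanSpace.inner_single_left]
    simp [mul_comm]
  simp only [e1, e2]
  refine isClosed_eq ?_ ?_ <;> fun_prop

instance H1.instCompleteSpace : CompleteSpace (H1 Ω) := isClosed_H1.completeSpace_coe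

/-- Existence of a trace operator. The trace inequality defines it on the closure in `H¹(Ω)` of the
functions smooth up to the boundary, and an orthogonal projection extends it to `H¹(Ω)`; that these
functions are in fact dense plays no role. -/
theorem exists_isTraceOperator (hΩ : IsSmoothBoundedDomain Ω) : ∃ T, IsTraceOperator Ω T := by
  obtain ⟨J, hJ⟩ := exists_smooth_to_H1 hΩ
  obtain ⟨C, hC, htr⟩ := exists_trace_inequality hΩ
  have hcl : IsCompact (closure (frontier Ω)) :=
    hΩ.isCompact_closure.of_isClosed_subset isClosed_closure
      (closure_minimal frontier_subset_closure isClosed_closure)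
  let f := toLpMap (μ := (μH[1] : Measure Plane).restrict (frontier Ω)) smoothFunctions.subtype
    fun φ => memLp_two_of_continuous isClosed_frontier.measurableSet hcl
      hΩ.hausdorffMeasure_frontier_ne_top (contDiff_of_smoothFunctions φ).continuous
  have hf : ∀ φ : smoothFunctions,
      f φ =ᵐ[(μH[1] : Measure Plane).restrict (frontier Ω)] (φ : Plane → ℝ) :=
    fun φ => toLpMap_coeFn _ _ φ
  have hbound : ∀ φ, ‖f φ‖ ≤ √C.toReal * ‖J φ‖ := by
    intro φ
    refine norm_le_of_enorm_sq_le hC ?_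
    have e1 : ∫⁻ x in Ω, ‖H1.toL2 (J φ) x‖ₑ ^ 2 = ∫⁻ x in Ω, ‖φ.1 x‖ₑ ^ 2 := by
      refine lintegral_congr_ae ?_
      filter_upwards [(hJ φ).1] with x hx
      rw [hx]
    have e2 : ∫⁻ x in Ω, ‖H1.grad (J φ) x‖ₑ ^ 2 = ∫⁻ x in Ω, ‖fderiv ℝ φ.1 x‖ₑ ^ 2 := by
      refine lintegral_congr_ae ?_
      filter_upwards [(hJ φ).2] with x hx
      rw [hx, enorm_fderiv_eq_enorm_gradient]
    have e3 : ∫⁻ x in frontier Ω, ‖f φ x‖ₑ ^ 2 ∂μH[1] =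
        ∫⁻ x in frontier Ω, ‖φ.1 x‖ₑ ^ 2 ∂μH[1] := by
      refine lintegral_congr_ae ?_
      filter_upwards [hf φ] with x hx
      rw [hx]
    rw [← lintegral_enorm_sq_eq, e3, H1.enorm_sq, ← lintegral_enorm_sq_eq, ← lintegral_enorm_sq_eq,
      e1, e2]
    exact htr φ.1 (contDiff_of_smoothFunctions φ)
  obtain ⟨T, hT⟩ := exists_clm_extension J f hbound
  refine ⟨T, fun v φ hφ hv => ?_⟩
  have hvJ : v = J ⟨φ, hφ⟩ := by
    refine H1.ext_toL2 hΩ.isOpen (Lp.ext ?_)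
    exact hv.trans (hJ ⟨φ, hφ⟩).1.symm
  rw [hvJ, hT]
  exact hf ⟨φ, hφ⟩

theorem isTraceOperator_trace (hΩ : IsSmoothBoundedDomain Ω) : IsTraceOperator Ω (trace Ω) := by
  have h := exists_isTraceOperator hΩ
  rw [trace, dif_pos h]
  exact h.choose_spec

/-! ### Friedrichs' inequality -/

variable {Γ₁ Γ₂ Γ₃ : Set Plane}

theorem exists_const_H1 (hΩ : IsSmoothBoundedDomain Ω) (c : ℝ) :
    ∃ w : H1 Ω, H1.toL2 w =ᵐ[volume.restrict Ω] (fun _ => c) ∧ H1.grad w = 0 ∧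
      trace Ω w =ᵐ[(μH[1] : Measure Plane).restrict (frontier Ω)] (fun _ => c) := by
  obtain ⟨J, hJ⟩ := exists_smooth_to_H1 hΩ
  have hc : ContDiff ℝ ∞ (fun _ : Plane => c) := contDiff_const
  obtain ⟨h1, h2⟩ := hJ ⟨_, hc⟩
  refine ⟨J ⟨_, hc⟩, h1, Lp.ext ?_, isTraceOperator_trace hΩ _ _ hc h1⟩
  filter_upwards [h2, Lp.coeFn_zero Plane 2 (volume.restrict Ω)] with x hx h0
  rw [hx, h0]
  simp [gradient]

/-- Friedrichs' inequality. If `‖v - c‖` is controlled by `‖∇v‖`, then so is the trace of `v - c`,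
which equals `-c` on `Γ₁`; as `Γ₁` has positive length this bounds `c`. -/
theorem exists_enorm_H1_sq_le (hΩ : IsSmoothBoundedDomain Ω) (hmeas : MeasurableSet Γ₁)
    (hsub : Γ₁ ⊆ frontier Ω) (hpos : 0 < μH[1] Γ₁) :
    ∃ C : ENNReal, C ≠ ⊤ ∧ ∀ v ∈ vanishingOn Ω Γ₁, ‖v‖ₑ ^ 2 ≤ C * ‖H1.grad v‖ₑ ^ 2 := by
  obtain ⟨C, hC, hPW⟩ := poincareWirtinger_self hΩ
  set τ := ‖trace Ω‖ₑ with hτ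
  set m := μH[1] Γ₁ with hm
  have hvol := hΩ.volume_ne_top
  refine ⟨2 * C + 2 * (τ ^ 2 * (C + 1) / m * volume Ω) + 1, ?_, fun v hv => ?_⟩
  · have := ENNReal.div_ne_top (x := τ ^ 2 * (C + 1)) (by finiteness) hpos.ne'
    finiteness
  obtain ⟨c, hc⟩ := hPW v
  rw [lintegral_enorm_sq_eq] at hc
  obtain ⟨k, hk, hkg, hkt⟩ := exists_const_H1 hΩ c
  set G := ‖H1.grad v‖ₑ ^ 2 with hG
  have hfst : ‖H1.toL2 (v - k)‖ₑ ^ 2 ≤ C * G := by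
    rw [← lintegral_enorm_sq_eq]
    refine le_trans (le_of_eq (lintegral_congr_ae ?_)) hc
    filter_upwards [hk, Lp.coeFn_sub (H1.toL2 v) (H1.toL2 k)] with x hx hs
    change ‖(H1.toL2 v - H1.toL2 k : L2 Ω) x‖ₑ ^ 2 = _
    rw [hs, Pi.sub_apply, hx]
  have hw : ‖v - k‖ₑ ^ 2 ≤ (C + 1) * G := by
    rw [H1.enorm_sq]
    have : H1.grad (v - k) = H1.grad v := by
      change H1.grad v - H1.grad k = H1.grad v
      rw [hkg, sub_zero]
    rw [this, add_mul, one_mul]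
    gcongr
  have hcm : ‖c‖ₑ ^ 2 * m ≤ τ ^ 2 * ((C + 1) * G) := by
    have hae : ∀ᵐ x ∂(μH[1] : Measure Plane).restrict Γ₁, trace Ω (v - k) x = -c := by
      rw [map_sub]
      have h1 : ∀ᵐ x ∂(μH[1] : Measure Plane).restrict (frontier Ω),
          x ∈ Γ₁ → (trace Ω v - trace Ω k : L2Arc (frontier Ω)) x = -c := by
        have hv' : ∀ᵐ x ∂(μH[1] : Measure Plane).restrict (frontier Ω),
          x ∈ Γ₁ → trace Ω v x = 0 := hv
        filter_upwards [hv', hkt, Lp.coeFn_sub (trace Ω v) (trace Ω k)] with x h1 h2 h3 hx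
        rw [h3, Pi.sub_apply, h1 hx, h2, zero_sub]
      rwa [← ae_restrict_iff' hmeas, restrict_restrict_of_subset hsub] at h1
    calc ‖c‖ₑ ^ 2 * m = ∫⁻ x in Γ₁, ‖trace Ω (v - k) x‖ₑ ^ 2 ∂μH[1] := by
          rw [lintegral_congr_ae (g := fun _ => ‖c‖ₑ ^ 2)]
          · simp [hm]
          · filter_upwards [hae] with x hx
            rw [hx, enorm_neg]
      _ ≤ ∫⁻ x in frontier Ω, ‖trace Ω (v - k) x‖ₑ ^ 2 ∂μH[1] := lintegral_mono_set hsub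
      _ = ‖trace Ω (v - k)‖ₑ ^ 2 := lintegral_enorm_sq_eq _
      _ ≤ (τ * ‖v - k‖ₑ) ^ 2 := by
          gcongr
          exact (trace Ω).le_opENorm _
      _ ≤ τ ^ 2 * ((C + 1) * G) := by
          rw [mul_pow]
          gcongr
  have hc2 : ‖c‖ₑ ^ 2 ≤ τ ^ 2 * (C + 1) / m * G := by
    have hmt : m ≠ ⊤ :=
      ne_top_of_le_ne_top hΩ.hausdorffMeasure_frontier_ne_top (measure_mono hsub)
    rw [← ENNReal.mul_div_right_comm, ENNReal.le_div_iff_mul_le (Or.inl hpos.ne') (Or.inl hmt),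
      mul_assoc]
    exact hcm
  have hL2 : ‖H1.toL2 v‖ₑ ^ 2 ≤ 2 * (C * G) + 2 * (τ ^ 2 * (C + 1) / m * G) * volume Ω := by
    rw [← lintegral_enorm_sq_eq]
    calc ∫⁻ x in Ω, ‖H1.toL2 v x‖ₑ ^ 2
        ≤ ∫⁻ x in Ω, (2 * ‖H1.toL2 v x - c‖ₑ ^ 2 + 2 * ‖c‖ₑ ^ 2) := by
          refine lintegral_mono fun x => ?_
          have e : H1.toL2 v x = (H1.toL2 v x - c) + c := by ring
          conv_lhs => rw [e]
          exact enorm_add_sq_le _ _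
      _ = 2 * (∫⁻ x in Ω, ‖H1.toL2 v x - c‖ₑ ^ 2) + 2 * ‖c‖ₑ ^ 2 * volume Ω := by
          rw [lintegral_add_right _ measurable_const, lintegral_const_mul' _ _ (by finiteness)]
          simp
      _ ≤ _ := by gcongr
  rw [H1.enorm_sq]
  calc _ ≤ 2 * (C * G) + 2 * (τ ^ 2 * (C + 1) / m * G) * volume Ω + G := by gcongr
    _ = _ := by ring

/-! ### The mixed formulation on `X` -/

theorem X.exists_norm_toH1_le (hΩ : IsSmoothBoundedDomain Ω) (hmeas : MeasurableSet Γ₁)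
    (hsub : Γ₁ ⊆ frontier Ω) (hpos : 0 < μH[1] Γ₁) :
    ∃ C : ℝ, 0 ≤ C ∧ ∀ v : X Ω Γ₁, ‖X.toH1 v‖ ≤ C * ‖v‖ := by
  obtain ⟨C, hC, h⟩ := exists_enorm_H1_sq_le hΩ hmeas hsub hpos
  exact ⟨√C.toReal, Real.sqrt_nonneg _, fun v => norm_le_of_enorm_sq_le (y := X.grad v) hC
    (h (X.toH1 v) (v : vanishingOn Ω Γ₁).2)⟩

theorem X.norm_le_norm_toH1 (v : X Ω Γ₁) : ‖v‖ ≤ ‖X.toH1 v‖ := by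
  have h : ‖X.toH1 v‖ ^ 2 = ‖H1.toL2 (X.toH1 v)‖ ^ 2 + ‖v‖ ^ 2 :=
    WithLp.prod_norm_sq_eq_of_L2 (X.toH1 v).1
  exact le_of_sq_le_sq (by nlinarith [sq_nonneg ‖H1.toL2 (X.toH1 v)‖]) (norm_nonneg _)

theorem isClosed_vanishingOn (hmeas : MeasurableSet Γ₁) :
    IsClosed (vanishingOn Ω Γ₁ : Set (H1 Ω)) := by
  let R := LpToLpRestrictCLM Plane ℝ ℝ ((μH[1] : Measure Plane).restrict (frontier Ω)) 2 Γ₁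
  have hset : (vanishingOn Ω Γ₁ : Set (H1 Ω)) = {v | R (trace Ω v) = 0} := by
    ext v
    have h1 := LpToLpRestrictCLM_coeFn ℝ Γ₁ (trace Ω v)
    change (∀ᵐ x ∂((μH[1] : Measure Plane).restrict (frontier Ω)), x ∈ Γ₁ → trace Ω v x = 0) ↔
      R (trace Ω v) = 0
    rw [← ae_restrict_iff' hmeas, Lp.eq_zero_iff_ae_eq_zero]
    exact ⟨fun h => h1.trans h, fun h => h1.symm.trans h⟩
  rw [hset]
  exact isClosed_eq (by fun_prop) continuous_const

theorem X.completeSpace (hΩ : IsSmoothBoundedDomain Ω) (hmeas : MeasurableSet Γ₁)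
    (hsub : Γ₁ ⊆ frontier Ω) (hpos : 0 < μH[1] Γ₁) : CompleteSpace (X Ω Γ₁) := by
  obtain ⟨C, hC, h⟩ := X.exists_norm_toH1_le hΩ hmeas hsub hpos
  have hcl : CompleteSpace (vanishingOn Ω Γ₁) := (isClosed_vanishingOn hmeas).completeSpace_coe
  let E : vanishingOn Ω Γ₁ ≃ₗ[ℝ] X Ω Γ₁ := LinearEquiv.refl ℝ (vanishingOn Ω Γ₁)
  let F : vanishingOn Ω Γ₁ ≃L[ℝ] X Ω Γ₁ := by
    refine ⟨E, ?_, ?_⟩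
    · exact (E.toLinearMap.mkContinuous 1 fun v => by
        rw [one_mul]; exact X.norm_le_norm_toH1 (E v)).continuous
    · exact (E.symm.toLinearMap.mkContinuous C fun v => h v).continuous
  exact (completeSpace_congr (e := F.toEquiv) F.isUniformEmbedding).1 hcl

theorem exists_load_clm (hΩ : IsSmoothBoundedDomain Ω) (hmeas : MeasurableSet Γ₁)
    (hsub : Γ₁ ⊆ frontier Ω) (hpos : 0 < μH[1] Γ₁) (hsub₂ : Γ₂ ⊆ frontier Ω) (hm₂ : MeasurableSet Γ₂) (f₀ : L2 Ω)
    (f₂ : L2Arc Γ₂) :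
    ∃ ℓ : StrongDual ℝ (X Ω Γ₁), ∀ v, ℓ v = load f₀ f₂ v := by
  obtain ⟨C, hC, h⟩ := X.exists_norm_toH1_le hΩ hmeas hsub hpos
  have hm : MemLp (Γ₂.indicator f₂) 2 ((μH[1] : Measure Plane).restrict (frontier Ω)) := by
    rw [memLp_indicator_iff_restrict hm₂, restrict_restrict_of_subset hsub₂]
    exact Lp.memLp f₂
  set G : L2Arc (frontier Ω) := hm.toLp _ with hG
  have hload : ∀ v : X Ω Γ₁, load f₀ f₂ v = ⟪f₀, v.toL2⟫ + ⟪G, v.tr⟫ := by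
    intro v
    rw [load, L2.inner_def, L2.inner_def]
    congr 1
    · refine integral_congr_ae (Eventually.of_forall fun x => ?_)
      simp [mul_comm]
    · have e1 : ∫ x in frontier Ω, ⟪G x, v.tr x⟫ ∂μH[1] =
          ∫ x in frontier Ω, Γ₂.indicator (fun x => f₂ x * v.tr x) x ∂μH[1] := by
        refine integral_congr_ae ?_
        filter_upwards [hm.coeFn_toLp] with x hx
        rw [hG, hx]
        by_cases hxΓ : x ∈ Γ₂ <;> simp [hxΓ, mul_comm]
      rw [e1, integral_indicator hm₂, restrict_restrict_of_subset hsub₂]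
  let L : X Ω Γ₁ →ₗ[ℝ] ℝ :=
    { toFun := fun v => ⟪f₀, v.toL2⟫ + ⟪G, v.tr⟫
      map_add' := fun v w => by
        have e1 : (v + w).toL2 = v.toL2 + w.toL2 := rfl
        have e2 : (v + w).tr = v.tr + w.tr := by simp [X.tr, map_add]
        rw [e1, e2, inner_add_right, inner_add_right]
        ring
      map_smul' := fun c v => by
        have e1 : (c • v).toL2 = c • v.toL2 := rfl
        have e2 : (c • v).tr = c • v.tr := by simp [X.tr, map_smul]
        rw [e1, e2, real_inner_smul_right, real_inner_smul_right, RingHom.id_apply, smul_eq_mul]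
        ring }
  refine ⟨L.mkContinuous ((‖f₀‖ + ‖G‖ * ‖trace Ω‖) * C) fun v => ?_, fun v => (hload v).symm⟩
  have h1 : ‖v.toL2‖ ≤ ‖X.toH1 v‖ := by
    have h : ‖X.toH1 v‖ ^ 2 = ‖v.toL2‖ ^ 2 + ‖v‖ ^ 2 :=
      WithLp.prod_norm_sq_eq_of_L2 (X.toH1 v).1
    exact le_of_sq_le_sq (by nlinarith [sq_nonneg ‖v‖]) (norm_nonneg _)
  have h2 : ‖v.tr‖ ≤ ‖trace Ω‖ * ‖X.toH1 v‖ := (trace Ω).le_opNorm _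
  calc ‖⟪f₀, v.toL2⟫ + ⟪G, v.tr⟫‖ ≤ ‖f₀‖ * ‖v.toL2‖ + ‖G‖ * ‖v.tr‖ :=
        (norm_add_le _ _).trans (add_le_add (norm_inner_le_norm _ _) (norm_inner_le_norm _ _))
    _ ≤ ‖f₀‖ * ‖X.toH1 v‖ + ‖G‖ * (‖trace Ω‖ * ‖X.toH1 v‖) := by gcongr
    _ = (‖f₀‖ + ‖G‖ * ‖trace Ω‖) * ‖X.toH1 v‖ := by ring
    _ ≤ (‖f₀‖ + ‖G‖ * ‖trace Ω‖) * (C * ‖v‖) := by gcongr; exact h v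
    _ = _ := by ring

theorem convex_multipliers (g : ℝ) : Convex ℝ (multipliers Ω Γ₁ Γ₃ g) := by
  intro μ hμ ν hν s t hs ht hst v
  calc (s • μ + t • ν) v = s * μ v + t * ν v := rfl
    _ ≤ s * friction Γ₃ g v + t * friction Γ₃ g v :=
        add_le_add (mul_le_mul_of_nonneg_left (hμ v) hs) (mul_le_mul_of_nonneg_left (hν v) ht)
    _ = friction Γ₃ g v := by rw [← add_mul, hst, one_mul]

theorem isClosed_multipliers (g : ℝ) : IsClosed (multipliers Ω Γ₁ Γ₃ g) := by
  have : multipliers Ω Γ₁ Γ₃ g = ⋂ v : X Ω Γ₁, {μ | μ v ≤ friction Γ₃ g v} := by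
    ext μ
    simp [multipliers]
  rw [this]
  exact isClosed_iInter fun v => isClosed_le (ContinuousEvalConst.continuous_eval_const v) continuous_const

theorem zero_mem_multipliers {g : ℝ} (hg : 0 ≤ g) : 0 ∈ multipliers Ω Γ₁ Γ₃ g := by
  intro v
  exact integral_nonneg fun x => mul_nonneg hg (abs_nonneg _)

end AntiplaneFriction

open AntiplaneFriction in
theorem theorem3p3 (Ω Γ₁ Γ₂ Γ₃ : Set AntiplaneFriction.Plane)
    (hΩ : AntiplaneFriction.IsSmoothBoundedDomain Ω)
    (hΓ : AntiplaneFriction.IsBoundaryPartition Ω Γ₁ Γ₂ Γ₃)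
    (ξ g : ℝ) (hξ : 0 < ξ) (hg : 0 < g)
    (f₀ : AntiplaneFriction.L2 Ω) (f₂ : AntiplaneFriction.L2Arc Γ₂) :
    ∃! p : AntiplaneFriction.X Ω Γ₁ × AntiplaneFriction.multipliers Ω Γ₁ Γ₃ g,
      AntiplaneFriction.IsMixedSolution Γ₃ ξ g f₀ f₂ p.1 p.2 := by
  have hsub₁ : Γ₁ ⊆ frontier Ω := fun x hx => hΓ.union_eq ▸ Or.inl (Or.inl hx)
  have hsub₂ : Γ₂ ⊆ frontier Ω := fun x hx => hΓ.union_eq ▸ Or.inl (Or.inr hx)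
  obtain ⟨C, hC, hnorm⟩ := X.exists_norm_toH1_le hΩ hΓ.measurable₁ hsub₁ hΓ.pos₁
  obtain ⟨ℓ, hℓ⟩ := exists_load_clm hΩ hΓ.measurable₁ hsub₁ hΓ.pos₁ hsub₂ hΓ.measurable₂ f₀ f₂
  -- On `X` the seminorm `‖∇v‖` is a norm, by Friedrichs' inequality; the topology, hence the dual,
  -- is unchanged.
  let N : NormedAddCommGroup (X Ω Γ₁) :=
    { (inferInstance : SeminormedAddCommGroup (X Ω Γ₁)) with
      eq_of_dist_eq_zero := by
        intro v w hvw
        have h0 : ‖X.toH1 (v - w)‖ ≤ 0 := by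
          refine (hnorm (v - w)).trans ?_
          rw [← dist_eq_norm, hvw, mul_zero]
        have h1 : X.toH1 (v - w) = 0 := norm_le_zero_iff.1 h0
        have h2 : X.toH1 v = X.toH1 w := by rwa [map_sub, sub_eq_zero] at h1
        exact Subtype.ext h2 }
  have hcomp : CompleteSpace (X Ω Γ₁) := X.completeSpace hΩ hΓ.measurable₁ hsub₁ hΓ.pos₁
  have key := existsUnique_saddle (E := X Ω Γ₁) (K := multipliers Ω Γ₁ Γ₃ g)
    ⟨0, zero_mem_multipliers hg.le⟩ (isClosed_multipliers g) (convex_multipliers g) hξ ℓ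
  obtain ⟨p, ⟨h1, h2⟩, huniq⟩ := key
  refine ⟨p, ⟨fun v => (h1 v).trans (hℓ v), h2⟩, fun q hq => huniq q ⟨fun v => ?_, hq.inequality⟩⟩
  exact (hq.equation v).trans (hℓ v).symm
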